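/- **Notation.** Let $\delta=2^{-n}$, $n\in\{0,1,2,\dots\}$. A dyadic $\delta$-square is a half-open square $[k\delta,(k+1)\delta)\times[l\delta,(l+1)\delta)$, $k,l\in\mathbb Z$; for $A\subset\mathbb R^2$, $\mathcal D_\delta(A)$ is the set of dyadic $\delta$-squares meeting $A$. For $(\theta,r)\in[0,1)\times\mathbb R$ let $\ell_{\theta,r}=\{z\in\mathbb R^2: z\cdot(\cos 2\pi\theta,\sin 2\pi\theta)=r\}$. For a dyadic $\delta$-square $Q\subset[0,1)\times\mathbb R$ put $T(Q)=\bigcup_{(\theta,r)\in Q}\ell_{\theta,r}$; these sets are the dyadic $\delta$-tubes, and $\mathcal T^\delta$ is the family of all of them. For $\mathcal T\subset\mathcal T^\delta$ let $P(\mathcal T)\subset\mathbb R^2$ be the union of the parameter squares $Q\subset[0,1)\times\mathbb R$ with $T(Q)\in\mathcal T$. All balls are closed, and $|P|_\delta$ is the least number of balls of radius $\delta$ needed to cover $P$. A set $P\subset\mathbb R^2$ is a $(\delta,s,C)$-set if $|P\cap B(x,r)|_\delta\le Cr^s|P|_\delta$ for all $x\in\mathbb R^2$, $r\ge\delta$,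 and a Katz–Tao $(\delta,s,C)$-set if $|P\cap B(x,r)|_\delta\le C(r/\delta)^s$ for all $x\in\mathbb R^2$, $r\ge\delta$. A family $\mathcal T\subset\mathcal T^\delta$ is called a $(\delta,s,C)$-set (respectively a Katz–Tao $(\delta,s,C)$-set) if $P(\mathcal T)$ is one. Finally, $\mathcal H^{s}_{\delta,\infty}(\mathcal T)$ is the infimum of $\sum_i \operatorname{diam}(B_i)^s$ over all countable coverings of $P(\mathcal T)$ by balls $B_i$ with radii in $[\delta,\infty)$. **Theorem.** There is an absolute constant $K>0$ such that the following holds. Let $t\in(1,2]$, $s\in(2-t,1]$ and $\sigma\in[0,s)$. There is a constant $c=c(\sigma,s,t)>0$ such that, whenever $C\ge1$, $\delta\in\{2^{-n}:n=0,1,2,\dots\}$, and $\mu$ is a Borel measure on $\mathbb R^2$ concentrated on $B(0,1)$ with $\mu(B(x,r))\le Cr^t$ for all $x\in\mathbb R^2$ and $r>0$, and whenever to every $p\in\mathcal D_\delta(\operatorname{spt}\mu)$ there is associated a non-empty $(\delta,s,C)$-set $\mathcal T_p\subset\mathcal T^\delta$ such that $T\cap p\ne\emptyset$ for all $T\in\mathcal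 T_p$, then the union $\mathcal T=\bigcup_{p\in\mathcal D_\delta(\operatorname{spt}\mu)}\mathcal T_p$ satisfies $$\mathcal H^{\sigma+1}_{\delta,\infty}(\mathcal T)\ \ge\ c\,\frac{\mu(\mathbb R^2)}{C^3},$$ and $\mathcal T$ contains a Katz–Tao $(\delta,\sigma+1,K)$-set $\mathcal T'$ of cardinality $$|\mathcal T'|\ \ge\ c\,\frac{\mu(\mathbb R^2)\,\delta^{-(\sigma+1)}}{C^3}.$$ -/

import Mathlib

open scoped ENNReal

namespace Furstenberg

noncomputable section

/-- The Euclidean plane; it also serves as the ambient plane of the line parameters `(θ, r)`. -/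
abbrev Plane := EuclideanSpace ℝ (Fin 2)

/-- The half-open square with side `δ` and lower left corner `(k 0 * δ, k 1 * δ)`. -/
def gridSquare (δ : ℝ) (k : Fin 2 → ℤ) : Set Plane :=
  {x | ∀ i, x i ∈ Set.Ico ((k i : ℝ) * δ) (((k i : ℝ) + 1) * δ)}

/-- The standard dyadic `δ`-squares of the plane (for `δ = 2 ^ (-n)`). -/
def dyadicSquares (δ : ℝ) : Set (Set Plane) := Set.range (gridSquare δ)

/-- The dyadic `δ`-squares that meet `A`. -/
def dyadicSquaresMeeting (δ : ℝ) (A : Set Plane) : Set (Set Plane) :=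
  {p ∈ dyadicSquares δ | (p ∩ A).Nonempty}

/-- The dyadic `δ`-squares contained in the strip `[0,1) × ℝ` of line parameters. -/
def paramSquares (δ : ℝ) : Set (Set Plane) :=
  {Q ∈ dyadicSquares δ | ∀ q ∈ Q, q 0 ∈ Set.Ico (0 : ℝ) 1}

/-- `π_θ(z) = z · (cos 2πθ, sin 2πθ)`. -/
def proj (θ : ℝ) (z : Plane) : ℝ :=
  z 0 * Real.cos (2 * Real.pi * θ) + z 1 * Real.sin (2 * Real.pi * θ)

/-- The line `ℓ_{θ,r} = π_θ⁻¹{r}`. -/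
def line (θ r : ℝ) : Set Plane := {z | proj θ z = r}

/-- `T(Q)`, the union of the lines `ℓ_{θ,r}` with `(θ, r) ∈ Q`. -/
def tube (Q : Set Plane) : Set Plane := ⋃ q ∈ Q, line (q 0) (q 1)

/-- The family of all dyadic `δ`-tubes. -/
def dyadicTubes (δ : ℝ) : Set (Set Plane) := tube '' paramSquares δ

/-- The union of the parameter squares `Q` with `T(Q) ∈ 𝒯`. -/
def paramUnion (δ : ℝ) (𝒯 : Set (Set Plane)) : Set Plane :=
  ⋃₀ {Q ∈ paramSquares δ | tube Q ∈ 𝒯}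

/-- The `δ`-covering number: the least number of closed `δ`-balls needed to cover `P`. -/
def covNum {X : Type*} [MetricSpace X] (δ : ℝ) (P : Set X) : ℝ≥0∞ :=
  (Metric.externalCoveringNumber δ.toNNReal P : ℝ≥0∞)

/-- `(δ,s,C)`-sets: `|P ∩ B(x,r)|_δ ≤ C r^s |P|_δ` for all `x` and all `r ≥ δ`. -/
def IsDeltaSet {X : Type*} [MetricSpace X] (δ s C : ℝ) (P : Set X) : Prop :=
  ∀ x : X, ∀ r : ℝ, δ ≤ r →
    covNum δ (P ∩ Metric.closedBall x r) ≤ ENNReal.ofReal (C * r ^ s) * covNum δ P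

/-- Katz-Tao `(δ,s,C)`-sets: `|P ∩ B(x,r)|_δ ≤ C (r/δ)^s` for all `x` and all `r ≥ δ`. -/
def IsKatzTaoSet {X : Type*} [MetricSpace X] (δ s C : ℝ) (P : Set X) : Prop :=
  ∀ x : X, ∀ r : ℝ, δ ≤ r →
    covNum δ (P ∩ Metric.closedBall x r) ≤ ENNReal.ofReal (C * (r / δ) ^ s)

/-- A family of dyadic `δ`-tubes is a `(δ,s,C)`-set if the union of its parameter squares is. -/
def IsDeltaTubeSet (δ s C : ℝ) (𝒯 : Set (Set Plane)) : Prop :=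
  IsDeltaSet δ s C (paramUnion δ 𝒯)

/-- A family of dyadic `δ`-tubes is a Katz-Tao `(δ,s,C)`-set if the union of its parameter
squares is. -/
def IsKatzTaoTubeSet (δ s C : ℝ) (𝒯 : Set (Set Plane)) : Prop :=
  IsKatzTaoSet δ s C (paramUnion δ 𝒯)

/-- The `s`-dimensional Hausdorff content of `A` with respect to (finite or countable) coverings
by balls with radii in `[δ,∞)`. A ball with centre `b.1` and radius `b.2` contributes
`(2 * b.2) ^ s`, the `s`-th power of its diameter. -/
def hausdorffContent (δ s : ℝ) (A : Set Plane) : ℝ≥0∞ :=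
  ⨅ (𝓑 : Set (Plane × ℝ)) (_ : 𝓑.Countable) (_ : ∀ b ∈ 𝓑, δ ≤ b.2)
    (_ : A ⊆ ⋃ b ∈ 𝓑, Metric.closedBall b.1 b.2),
    ∑' b : 𝓑, ENNReal.ofReal ((2 * (b : Plane × ℝ).2) ^ s)

/-- The Hausdorff content of a family of dyadic `δ`-tubes is that of its parameter squares. -/
def tubeContent (δ s : ℝ) (𝒯 : Set (Set Plane)) : ℝ≥0∞ :=
  hausdorffContent δ s (paramUnion δ 𝒯)

end

end Furstenberg

/-! Both conclusions follow from one count. Put `u = σ + 1`. Among the parameter cells of all the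
tubes, choose a largest subset `S'` with at most `(2 ^ i) ^ u` members in each dyadic cell `i`
generations up, for `i ≤ n`. By maximality every tube cell lies in a saturated cell, one holding at
least half of what is allowed (`exists_maximal_spread_subset`). The spread of `S'` gives the content
bound by mass distribution (`le_hausdorffContent`) and the Katz–Tao property of its tubes
(`isKatzTaoTubeSet_image`). What remains is that `|S'| δ ^ u` is at least a constant times `μ(ℝ²) /
C³`.

Each `𝒯 p` is a `(δ,s,C)`-set covered by saturated cells, so it meets many of them at some
generation. A second pigeonholing, by mass, yields one scale `ρ` at which points of mass about `ρ ^
ε M` (`M` the total mass) are each within `O(ρ)` of at least about `ρ ^ (ε - s) / C` lines coming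
from saturated cells. Give each such line the weight `ρ ^ (v + 1)`, where `σ ≤ v` and `2 - t < v <
s`, and let `W` be the total weight. With `ε = (s - v) / 2` the weighted incidences, normalised by
`1 / ρ`, are at least about `M / C`. The incidence theorem bounds them by `M W + A √(C M W)` up to
constants, which forces `W ≥ c M / C³` (`exists_generation_weight_ge`). Saturated cells are disjoint
and half full, so `W ≤ 2 |S'| δ ^ u`.

The incidence theorem (`smoothedIncidence_le`) compares consecutive scales. Incidences are smoothed
by the Cauchy kernel, which is positive semidefinite even with varying widths because it is a
Laplace transform of cosines. Positivity bounds the change from scale `l` to scale `2l` by a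
line–line energy plus a point–point energy. In the latter, averaging over all directions turns the
kernel into `1 / √(Λ² + |p - p'|²)`, and the combination that appears is a second difference: the
decay improves from `1 / d` to `l² / d³`, so growth of dimension `t ≤ 2` suffices. Optimising the
two energies gives `√(C B M W) l ^ ((t + u - 3) / 2)` for line weights of dimension `u` and growth
constant `B`. This is summable over dyadic `l` when `t + u > 3`. -/

namespace Furstenberg

/-! ### The Cauchy kernel: positivity and averages over directions -/

/-- The Cauchy kernel `Λ / (Λ² + x²)`. -/
noncomputable def cauchyKernel (Λ x : ℝ) : ℝ := Λ / (Λ ^ 2 + x ^ 2)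

lemma cauchyKernel_nonneg {Λ : ℝ} (hΛ : 0 ≤ Λ) (x : ℝ) : 0 ≤ cauchyKernel Λ x := by
  unfold cauchyKernel; positivity

lemma cauchyKernel_sub_comm (Λ x y : ℝ) : cauchyKernel Λ (x - y) = cauchyKernel Λ (y - x) := by
  unfold cauchyKernel; rw [← neg_sub, neg_sq]

/-- Both are the real part of the Laplace transform of a complex exponential. The width `Λ` enters
only through `exp (-Λ τ)`, which is multiplicative in `Λ`; this is what makes sums of widths
compatible with positivity. -/
lemma integral_exp_mul_cos {Λ : ℝ} (hΛ : 0 < Λ) (x : ℝ) :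
    MeasureTheory.IntegrableOn (fun τ : ℝ => Real.exp (-Λ * τ) * Real.cos (x * τ)) (Set.Ioi 0) ∧
    ∫ τ in Set.Ioi (0 : ℝ), Real.exp (-Λ * τ) * Real.cos (x * τ) = cauchyKernel Λ x := by
  set a : ℂ := -Λ + x * Complex.I with ha
  have hre : a.re < 0 := by simp [ha, hΛ]
  have hpt : ∀ τ : ℝ, Real.exp (-Λ * τ) * Real.cos (x * τ) = (Complex.exp (a * τ)).re := by
    intro τ
    rw [Complex.exp_re]
    simp [ha]
  have hint := integrableOn_exp_mul_complex_Ioi hre 0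
  simp_rw [hpt]
  refine ⟨hint.re, ?_⟩
  have h := integral_exp_mul_complex_Ioi hre 0
  have h2 : ∫ τ in Set.Ioi (0 : ℝ), (Complex.exp (a * τ)).re =
      (∫ τ in Set.Ioi (0 : ℝ), Complex.exp (a * τ)).re := by
    simpa using! integral_re hint
  rw [h2, h]
  simp only [Complex.ofReal_zero, mul_zero, Complex.exp_zero, cauchyKernel]
  simp [Complex.div_re, ha, Complex.normSq_apply]
  ring_nf

/-- The kernel `((λ, x), (λ', x')) ↦ cauchyKernel (λ + λ') (x - x')` is positive semidefinite. -/
lemma cauchyKernel_posSemidef {ι : Type*} (s : Finset ι) (c l x : ι → ℝ) (hl : ∀ i ∈ s, 0 < l i) :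
    0 ≤ ∑ i ∈ s, ∑ j ∈ s, c i * c j * cauchyKernel (l i + l j) (x i - x j) := by
  have h1 : ∑ i ∈ s, ∑ j ∈ s, c i * c j * cauchyKernel (l i + l j) (x i - x j) =
      ∫ τ in Set.Ioi (0 : ℝ), ∑ i ∈ s, ∑ j ∈ s,
        c i * c j * (Real.exp (-(l i + l j) * τ) * Real.cos ((x i - x j) * τ)) := by
    rw [MeasureTheory.integral_finsetSum]
    · refine Finset.sum_congr rfl fun i hi => ?_
      rw [MeasureTheory.integral_finsetSum]
      · refine Finset.sum_congr rfl fun j hj => ?_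
        rw [MeasureTheory.integral_const_mul,
          (integral_exp_mul_cos (add_pos (hl i hi) (hl j hj)) _).2]
      · exact fun j hj => (integral_exp_mul_cos (add_pos (hl i hi) (hl j hj)) _).1.const_mul _
    · refine fun i hi => MeasureTheory.integrable_finsetSum _ fun j hj => ?_
      exact (integral_exp_mul_cos (add_pos (hl i hi) (hl j hj)) _).1.const_mul _
  rw [h1]
  refine MeasureTheory.integral_nonneg fun τ => ?_
  -- For fixed `τ` the double sum is the squared modulus of the sum of `c i * exp (-l i τ) * exp (i
  -- x i τ)`.
  have h2 : ∑ i ∈ s, ∑ j ∈ s,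
        c i * c j * (Real.exp (-(l i + l j) * τ) * Real.cos ((x i - x j) * τ)) =
      (∑ i ∈ s, c i * Real.exp (-l i * τ) * Real.cos (x i * τ)) ^ 2 +
      (∑ i ∈ s, c i * Real.exp (-l i * τ) * Real.sin (x i * τ)) ^ 2 := by
    rw [sq, sq, Finset.sum_mul_sum, Finset.sum_mul_sum, ← Finset.sum_add_distrib]
    refine Finset.sum_congr rfl fun i _ => ?_
    rw [← Finset.sum_add_distrib]
    refine Finset.sum_congr rfl fun j _ => ?_
    rw [sub_mul, Real.cos_sub, neg_add, add_mul, Real.exp_add]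
    ring
  simp only [Pi.zero_apply]
  rw [h2]
  positivity

/-- `π_x(a, b)`, in coordinates. -/
noncomputable def angleForm (x a b : ℝ) : ℝ :=
  a * Real.cos (2 * Real.pi * x) + b * Real.sin (2 * Real.pi * x)

lemma continuous_angleForm (a b : ℝ) : Continuous fun x => angleForm x a b := by
  unfold angleForm; fun_prop

lemma continuous_cauchyKernel {Λ : ℝ} (hΛ : 0 < Λ) : Continuous (cauchyKernel Λ) := by
  unfold cauchyKernel
  refine Continuous.div₀ (by fun_prop) (by fun_prop) fun x => ?_
  positivity

lemma angleForm_add_one (x a b : ℝ) : angleForm (x + 1) a b = angleForm x a b := by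
  unfold angleForm
  rw [mul_add, mul_one, Real.cos_add_two_pi, Real.sin_add_two_pi]

lemma angleForm_sub (x h a b : ℝ) : angleForm (x - h) a b =
    angleForm x (a * Real.cos (2 * Real.pi * h) - b * Real.sin (2 * Real.pi * h))
      (a * Real.sin (2 * Real.pi * h) + b * Real.cos (2 * Real.pi * h)) := by
  unfold angleForm
  rw [mul_sub, Real.cos_sub, Real.sin_sub]
  ring

lemma angleForm_sub_angleForm (x a b a' b' : ℝ) :
    angleForm x a b - angleForm x a' b' = angleForm x (a - a') (b - b') := by
  unfold angleForm; ring

lemma exists_angleForm_polar (a b : ℝ) : ∃ y, ∀ x,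
    angleForm x a b = Real.sqrt (a ^ 2 + b ^ 2) * Real.cos (2 * Real.pi * (x - y)) := by
  set z : ℂ := ⟨a, b⟩ with hz
  have hn : Real.sqrt (a ^ 2 + b ^ 2) = ‖z‖ := by
    rw [Complex.norm_def, Complex.normSq_apply]; simp [hz, sq]
  have h := Complex.norm_mul_cos_arg z
  have h' := Complex.norm_mul_sin_arg z
  refine ⟨z.arg / (2 * Real.pi), fun x => ?_⟩
  have e : 2 * Real.pi * (x - z.arg / (2 * Real.pi)) = 2 * Real.pi * x - z.arg := by
    field_simp
  have ha : a = z.re := rfl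
  have hb : b = z.im := rfl
  rw [e, Real.cos_sub, hn, angleForm, ha, hb, ← h, ← h']
  ring

/-- The mean of the Cauchy kernel over the circle. -/
lemma integral_cauchyKernel_mul_cos {Λ : ℝ} (hΛ : 0 < Λ) (R : ℝ) :
    ∫ x in (0 : ℝ)..1, cauchyKernel Λ (R * Real.cos (2 * Real.pi * x)) =
      1 / Real.sqrt (Λ ^ 2 + R ^ 2) := by
  set S := Real.sqrt (Λ ^ 2 + R ^ 2) with hS
  have hSpos : 0 < S := Real.sqrt_pos.2 (by positivity)
  have hS2 : S ^ 2 = Λ ^ 2 + R ^ 2 := Real.sq_sqrt (by positivity)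
  -- This is the globally smooth branch of the antiderivative `arctan ((Λ / S) tan φ) / S`: the
  -- addition formula for `tan`, applied to its difference with `φ / S`, removes the poles of `tan`.
  set H : ℝ → ℝ := fun φ => (φ + Real.arctan ((Λ - S) * (Real.sin φ * Real.cos φ) /
    (S * Real.cos φ ^ 2 + Λ * Real.sin φ ^ 2))) / S with hH
  have hden : ∀ φ, 0 < S * Real.cos φ ^ 2 + Λ * Real.sin φ ^ 2 := by
    intro φ
    have := Real.sin_sq_add_cos_sq φ
    by_cases hc : Real.cos φ = 0
    · have : Real.sin φ ^ 2 = 1 := by rw [hc] at this; linarith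
      rw [hc, this]; simpa using hΛ
    · positivity
  have hder : ∀ φ, HasDerivAt H (cauchyKernel Λ (R * Real.cos φ)) φ := by
    intro φ
    have hs := Real.hasDerivAt_sin φ
    have hc := Real.hasDerivAt_cos φ
    have h1 := ((hs.mul hc).const_mul (Λ - S))
    have h2 := (((hc.pow 2).const_mul S).add ((hs.pow 2).const_mul Λ))
    have h3 := (((hasDerivAt_id φ).add (h1.div h2 (hden φ).ne').arctan)).div_const S
    refine h3.congr_deriv ?_
    have hd := hden φ
    have e := Real.sin_sq_add_cos_sq φ
    simp only [Pi.mul_apply, Pi.add_apply, Pi.pow_apply, Pi.div_apply, id] at *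
    have hR : R ^ 2 = S ^ 2 - Λ ^ 2 := by linarith
    have hq : 0 < Λ ^ 2 + (R * Real.cos φ) ^ 2 := by positivity
    rw [cauchyKernel]
    generalize Real.sin φ = u at *
    generalize Real.cos φ = v at *
    have hq' : Λ ^ 2 + (R * v) ^ 2 = Λ ^ 2 * u ^ 2 + S ^ 2 * v ^ 2 := by
      rw [mul_pow, hR]; linear_combination (-Λ ^ 2) * e
    have hsum : (S * v ^ 2 + Λ * u ^ 2) ^ 2 + ((Λ - S) * (u * v)) ^ 2 =
        Λ ^ 2 * u ^ 2 + S ^ 2 * v ^ 2 := by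
      linear_combination (Λ ^ 2 * u ^ 2 + S ^ 2 * v ^ 2) * e
    rw [hq'] at hq ⊢
    have hone : 1 + ((Λ - S) * (u * v) / (S * v ^ 2 + Λ * u ^ 2)) ^ 2 =
        (Λ ^ 2 * u ^ 2 + S ^ 2 * v ^ 2) / (S * v ^ 2 + Λ * u ^ 2) ^ 2 := by
      rw [← hsum]; field_simp
    rw [hone]
    have hv : v ^ 2 = 1 - u ^ 2 := by linarith
    field_simp
    push_cast
    simp only [pow_one]
    have hv4 : v ^ 4 = (1 - u ^ 2) ^ 2 := by rw [← hv]; ring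
    ring_nf
    simp only [hv, hv4]
    ring
  have hcont : Continuous fun φ => cauchyKernel Λ (R * Real.cos φ) :=
    (continuous_cauchyKernel hΛ).comp (by fun_prop)
  have hcomp : ∫ x in (0 : ℝ)..1, cauchyKernel Λ (R * Real.cos (2 * Real.pi * x)) =
      (2 * Real.pi)⁻¹ * ∫ φ in (0 : ℝ)..(2 * Real.pi), cauchyKernel Λ (R * Real.cos φ) := by
    rw [intervalIntegral.integral_comp_mul_left
      (fun φ => cauchyKernel Λ (R * Real.cos φ)) (by positivity)]
    simp
  rw [hcomp, intervalIntegral.integral_eq_sub_of_hasDerivAt (fun φ _ => hder φ)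
    (hcont.intervalIntegrable _ _)]
  simp only [hH, Real.sin_two_pi, Real.sin_zero, Real.cos_two_pi, Real.cos_zero]
  have := Real.pi_pos
  field_simp
  simp

/-- In polar form the projection is a rotated cosine, so each period contributes the circle mean.
Two periods are used so that every interval `(θ - l, θ]` with `θ ∈ [0,1]` and `l ≤ 1` fits inside
the range of integration. -/
lemma integral_cauchyKernel_angleForm {Λ : ℝ} (hΛ : 0 < Λ) (a b : ℝ) :
    ∫ x in (-1 : ℝ)..1, cauchyKernel Λ (angleForm x a b) =
      2 / Real.sqrt (Λ ^ 2 + (a ^ 2 + b ^ 2)) := by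
  set f := fun x => cauchyKernel Λ (angleForm x a b) with hf
  have hper : Function.Periodic f 1 := fun x => by simp only [hf, angleForm_add_one]
  have hcont : Continuous f := (continuous_cauchyKernel hΛ).comp (continuous_angleForm a b)
  have key : ∀ t : ℝ, ∫ x in t..(t + 1), f x = 1 / Real.sqrt (Λ ^ 2 + (a ^ 2 + b ^ 2)) := by
    intro t
    obtain ⟨y, hy⟩ := exists_angleForm_polar a b
    have h0 := integral_cauchyKernel_mul_cos hΛ (Real.sqrt (a ^ 2 + b ^ 2))
    rw [Real.sq_sqrt (by positivity)] at h0
    rw [hper.intervalIntegral_add_eq t y, ← h0]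
    have : ∀ x, f x = (fun z => cauchyKernel Λ (Real.sqrt (a ^ 2 + b ^ 2) *
        Real.cos (2 * Real.pi * z))) (x - y) := fun x => by simp only [hf, hy]
    simp_rw [this]
    rw [intervalIntegral.integral_comp_sub_right (fun z => cauchyKernel Λ
      (Real.sqrt (a ^ 2 + b ^ 2) * Real.cos (2 * Real.pi * z)))]
    simp
  have h1 := key (-1)
  have h2 := key 0
  norm_num at h1 h2
  rw [← intervalIntegral.integral_add_adjacent_intervals (hcont.intervalIntegrable (-1) 0)
    (hcont.intervalIntegrable 0 1), h1, h2]
  ring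

end Furstenberg

/-! ### Dyadic summation, the second-difference estimate and the positivity inequality -/

namespace Furstenberg

/-- A weight with `t`-dimensional growth integrates kernels decaying faster than `d ^ (-t)`. -/
lemma sum_mul_decay_le {ι : Type*} (s : Finset ι) (m d : ι → ℝ) (a : ℕ) {t C l : ℝ} (hl : 0 < l)
    (hC : 0 ≤ C) (hm : ∀ i ∈ s, 0 ≤ m i) (hd : ∀ i ∈ s, 0 ≤ d i) (hta : t < a)
    (h : ∀ k : ℕ, ∑ i ∈ s with d i ≤ 2 ^ k * l, m i ≤ C * (2 ^ k * l) ^ t) :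
    ∑ i ∈ s, m i * (l / (l + d i)) ^ a ≤
      2 ^ a * (1 - (2 : ℝ) ^ (t - a))⁻¹ * (C * l ^ t) := by
  obtain ⟨K, hK⟩ : ∃ K : ℕ, ∀ i ∈ s, d i ≤ 2 ^ K * l := by
    obtain ⟨K, hK⟩ := pow_unbounded_of_one_lt ((∑ i ∈ s, d i) / l) (one_lt_two : (1 : ℝ) < 2)
    refine ⟨K, fun i hi => ?_⟩
    rw [div_lt_iff₀ hl] at hK
    exact (Finset.single_le_sum hd hi).trans hK.le
  have hpt : ∀ i ∈ s, (l / (l + d i)) ^ a ≤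
      ∑ k ∈ Finset.range (K + 1), if d i ≤ 2 ^ k * l then 2 ^ a * ((1 / 2 : ℝ) ^ k) ^ a else 0 := by
    intro i hi
    classical
    have hex : ∃ k : ℕ, d i ≤ 2 ^ k * l := ⟨K, hK i hi⟩
    -- The least such `k` is the dyadic size of `d i / l`; failure at `k - 1` gives `l / (l + d i) ≤
    -- 2 * 2 ^ (-k)`. The single term `k` then dominates, and the other terms of the sum are
    -- nonnegative.
    set k := Nat.find hex
    have hk : d i ≤ 2 ^ k * l := Nat.find_spec hex
    have hkK : k ≤ K := Nat.find_min' hex (hK i hi)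
    have h1 : (l / (l + d i)) ≤ 2 * (1 / 2 : ℝ) ^ k := by
      have hdi := hd i hi
      rw [div_le_iff₀ (by positivity)]
      rcases Nat.eq_zero_or_pos k with h0 | h0
      · rw [h0]; simp; nlinarith
      · have h2 : ¬ d i ≤ 2 ^ (k - 1) * l := Nat.find_min hex (by omega)
        push Not at h2
        have h3 : (2 : ℝ) * (1 / 2) ^ k * (2 ^ (k - 1)) = 1 := by
          obtain ⟨k', hk'⟩ : ∃ k', k = k' + 1 := ⟨k - 1, by omega⟩
          rw [hk', pow_succ, Nat.add_sub_cancel, one_div, inv_pow]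
          field_simp
        have h4 : 0 < (2 : ℝ) * (1 / 2) ^ k := by positivity
        calc l = 2 * (1 / 2) ^ k * (2 ^ (k - 1)) * l := by rw [h3, one_mul]
          _ = 2 * (1 / 2) ^ k * (2 ^ (k - 1) * l) := by ring
          _ ≤ 2 * (1 / 2) ^ k * (l + d i) := by gcongr; linarith
    calc (l / (l + d i)) ^ a ≤ (2 * (1 / 2 : ℝ) ^ k) ^ a := by
          have := hd i hi
          gcongr
      _ = if d i ≤ 2 ^ k * l then 2 ^ a * ((1 / 2 : ℝ) ^ k) ^ a else 0 := by
          rw [if_pos hk, mul_pow]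
      _ ≤ _ := by
          refine Finset.single_le_sum
            (f := fun k => if d i ≤ 2 ^ k * l then 2 ^ a * ((1 / 2 : ℝ) ^ k) ^ a else 0)
            (fun k _ => ?_) (Finset.mem_range.2 (by omega))
          positivity
  have hx0 : (0 : ℝ) < 2 ^ (t - a) := by positivity
  have hx1 : (2 : ℝ) ^ (t - a) < 1 := Real.rpow_lt_one_of_one_lt_of_neg one_lt_two (by linarith)
  calc ∑ i ∈ s, m i * (l / (l + d i)) ^ a
      ≤ ∑ i ∈ s, m i * ∑ k ∈ Finset.range (K + 1),
        if d i ≤ 2 ^ k * l then 2 ^ a * ((1 / 2 : ℝ) ^ k) ^ a else 0 :=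
        Finset.sum_le_sum fun i hi => mul_le_mul_of_nonneg_left (hpt i hi) (hm i hi)
    _ = ∑ k ∈ Finset.range (K + 1), 2 ^ a * ((1 / 2 : ℝ) ^ k) ^ a *
        ∑ i ∈ s with d i ≤ 2 ^ k * l, m i := by
        simp_rw [Finset.mul_sum]
        rw [Finset.sum_comm]
        refine Finset.sum_congr rfl fun k _ => ?_
        rw [Finset.sum_filter]
        refine Finset.sum_congr rfl fun i _ => ?_
        split_ifs <;> ring
    _ ≤ ∑ k ∈ Finset.range (K + 1), 2 ^ a * ((1 / 2 : ℝ) ^ k) ^ a * (C * (2 ^ k * l) ^ t) := by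
        gcongr with k _
        exact h k
    _ = 2 ^ a * (C * l ^ t) * ∑ k ∈ Finset.range (K + 1), ((2 : ℝ) ^ (t - a)) ^ k := by
        rw [Finset.mul_sum]
        refine Finset.sum_congr rfl fun k _ => ?_
        rw [Real.mul_rpow (by positivity) hl.le, Real.rpow_sub two_pos, Real.rpow_natCast 2 a,
          ← Real.rpow_natCast 2 k, ← Real.rpow_mul two_pos.le, mul_comm (k : ℝ) t,
          Real.rpow_mul two_pos.le, Real.rpow_natCast, div_pow, one_pow,
          div_pow, div_pow, one_pow, ← pow_mul, ← pow_mul, mul_comm k a]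
        field_simp
    _ ≤ 2 ^ a * (C * l ^ t) * (1 - (2 : ℝ) ^ (t - a))⁻¹ := by
        gcongr
        have h1 := mul_neg_geom_sum ((2 : ℝ) ^ (t - a)) (K + 1)
        have h2 : 0 < 1 - (2 : ℝ) ^ (t - a) := by linarith
        rw [← one_div, le_div_iff₀ h2, mul_comm, h1]
        have := pow_pos hx0 (K + 1)
        linarith
    _ = _ := by ring

/-- Midpoint convexity of `Y ↦ Y ^ (-1/2)`, obtained here from AM–GM on the two square roots. -/
lemma two_div_sqrt_le {Y e : ℝ} (h1 : 0 < Y - e) (h2 : 0 < Y + e) :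
    2 / Real.sqrt Y ≤ 1 / Real.sqrt (Y - e) + 1 / Real.sqrt (Y + e) := by
  set p := Real.sqrt (Y - e)
  set q := Real.sqrt (Y + e)
  have hp : 0 < p := Real.sqrt_pos.2 h1
  have hq : 0 < q := Real.sqrt_pos.2 h2
  have hY : 0 < Y := by linarith
  have hz : 0 < Real.sqrt Y := Real.sqrt_pos.2 hY
  have hpq : p * q ≤ Y := by
    have := Real.sq_sqrt h1.le
    have := Real.sq_sqrt h2.le
    nlinarith [sq_nonneg (p - q)]
  have hpq2 : Real.sqrt (p * q) ≤ Real.sqrt Y := Real.sqrt_le_sqrt hpq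
  have hg : 0 < Real.sqrt (p * q) := Real.sqrt_pos.2 (by positivity)
  have hg2 : Real.sqrt (p * q) ^ 2 = p * q := Real.sq_sqrt (by positivity)
  have hsum : 2 * Real.sqrt (p * q) ≤ p + q := by
    refine le_of_sq_le_sq ?_ (by positivity)
    rw [mul_pow, hg2]; nlinarith [sq_nonneg (p - q)]
  calc 2 / Real.sqrt Y ≤ 2 / Real.sqrt (p * q) := by gcongr
    _ = 2 * Real.sqrt (p * q) / (p * q) := by
      nth_rw 3 [← hg2]; field_simp
    _ ≤ (p + q) / (p * q) := by gcongr
    _ = 1 / p + 1 / q := by field_simp; ring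

lemma one_div_sqrt_sub_le {X D : ℝ} (hX : 0 < X) (hD : 0 ≤ D) :
    1 / Real.sqrt X - 1 / Real.sqrt (X + D) ≤ D / (2 * Real.sqrt X ^ 3) := by
  set p := Real.sqrt X with hp'
  set q := Real.sqrt (X + D) with hq'
  have hp : 0 < p := Real.sqrt_pos.2 hX
  have hpq : p ≤ q := Real.sqrt_le_sqrt (by linarith)
  have hq : 0 < q := hp.trans_le hpq
  have hp2 : p ^ 2 = X := Real.sq_sqrt hX.le
  have hq2 : q ^ 2 = X + D := Real.sq_sqrt (by linarith)
  have e : 1 / p - 1 / q = D / (p * q * (p + q)) := by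
    have : D = (q - p) * (p + q) := by nlinarith
    rw [this]; field_simp
  rw [e]
  refine div_le_div_of_nonneg_left hD (by positivity) ?_
  calc 2 * p ^ 3 = p * p * (p + p) := by ring
    _ ≤ p * q * (p + q) := by gcongr

/-- Here `V` is a squared distance, while `V + e - f` and `V + e + f` are the squared distances
after one of the two points is rotated. The term `f` may be of first order in the rotation, but it
occurs with both signs and convexity removes it. What is left is a change of at most `52 l² = (16 -
4 + 40) l²` under the square root, and the derivative of `X ^ (-1/2)` turns this into cubic decay.
-/
lemma second_difference_le {l V e f d : ℝ} (hl : 0 < l) (hd : 0 ≤ d) (hdV : d ^ 2 ≤ V)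
    (he : e ≤ 40 * l ^ 2) (h1 : 0 ≤ V + e - f) (h2 : 0 ≤ V + e + f) :
    1 / Real.sqrt ((2 * l) ^ 2 + V) + 1 / Real.sqrt ((6 * l) ^ 2 + V)
      - 1 / Real.sqrt ((4 * l) ^ 2 + (V + e - f)) - 1 / Real.sqrt ((4 * l) ^ 2 + (V + e + f)) ≤
      416 / l * (l / (l + d)) ^ 3 := by
  have hV : 0 ≤ V := (sq_nonneg d).trans hdV
  have hl2 : 0 < l ^ 2 := by positivity
  have hA : 0 < (2 * l) ^ 2 + V := by positivity
  have a1 : 1 / Real.sqrt ((6 * l) ^ 2 + V) ≤ 1 / Real.sqrt ((2 * l) ^ 2 + V) := by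
    refine one_div_le_one_div_of_le (Real.sqrt_pos.2 hA) (Real.sqrt_le_sqrt ?_)
    nlinarith
  have a2 := two_div_sqrt_le (Y := (4 * l) ^ 2 + (V + e)) (e := f)
    (by nlinarith) (by nlinarith)
  have a3 : 2 / Real.sqrt (((2 * l) ^ 2 + V) + 52 * l ^ 2) ≤
      2 / Real.sqrt ((4 * l) ^ 2 + (V + e)) := by
    refine div_le_div_of_nonneg_left zero_le_two (Real.sqrt_pos.2 (by nlinarith))
      (Real.sqrt_le_sqrt (by nlinarith))
  have a4 := one_div_sqrt_sub_le hA (D := 52 * l ^ 2) (by positivity)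
  have a5 : (l + d) / 2 ≤ Real.sqrt ((2 * l) ^ 2 + V) := by
    refine Real.le_sqrt_of_sq_le ?_
    nlinarith [sq_nonneg (l - d)]
  have a6 : 52 * l ^ 2 / (2 * Real.sqrt ((2 * l) ^ 2 + V) ^ 3) ≤
      52 * l ^ 2 / (2 * ((l + d) / 2) ^ 3) := by
    gcongr
  have a7 : 2 * (52 * l ^ 2 / (2 * ((l + d) / 2) ^ 3)) = 416 / l * (l / (l + d)) ^ 3 := by
    field_simp; norm_num
  have e1 : (4 * l) ^ 2 + (V + e) - f = (4 * l) ^ 2 + (V + e - f) := by ring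
  have e2 : (4 * l) ^ 2 + (V + e) + f = (4 * l) ^ 2 + (V + e + f) := by ring
  rw [e1, e2] at a2
  have a8 : 2 / Real.sqrt (((2 * l) ^ 2 + V) + 52 * l ^ 2) =
    2 * (1 / Real.sqrt (((2 * l) ^ 2 + V) + 52 * l ^ 2)) := by ring
  linarith

/-- Writing `e(λ, x)` for the feature vector of the kernel, this is the expansion of `‖s ∑ n j e(l,
r j) - ∑ m i (e(l, A i) - e(3l, B i))‖² ≥ 0`, divided by `s`. Widths add in inner products, so `l`
and `3l` produce exactly the widths `2l`, `4l` and `6l`; the factor `s` is left free for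
optimisation. -/
lemma cauchyKernel_pairing_le {ι κ : Type*} (X : Finset ι) (Y : Finset κ) (m A B : ι → ℝ)
    (n r : κ → ℝ) {l s : ℝ} (hl : 0 < l) (hs : 0 < s) :
    2 * ∑ j ∈ Y, ∑ i ∈ X, n j * m i *
        (cauchyKernel (2 * l) (A i - r j) - cauchyKernel (4 * l) (B i - r j)) ≤
      s * ∑ j ∈ Y, ∑ j' ∈ Y, n j * n j' * cauchyKernel (2 * l) (r j - r j') +
      s⁻¹ * ∑ i ∈ X, ∑ i' ∈ X, m i * m i' *
        (cauchyKernel (2 * l) (A i - A i') + cauchyKernel (6 * l) (B i - B i')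
          - cauchyKernel (4 * l) (A i - B i') - cauchyKernel (4 * l) (B i - A i')) := by
  have h := cauchyKernel_posSemidef (Y.disjSum (X.disjSum X))
    (Sum.elim (fun j => s * n j) (Sum.elim (fun i => - m i) m))
    (Sum.elim (fun _ => l) (Sum.elim (fun _ => l) (fun _ => 3 * l)))
    (Sum.elim r (Sum.elim A B))
    (by rintro (j | i | i) _ <;> simp [hl])
  simp only [Finset.sum_disjSum, Sum.elim_inl, Sum.elim_inr] at h
  simp only [Finset.sum_add_distrib] at h
  have c2 : l + l = 2 * l := by ring
  have c4 : l + 3 * l = 4 * l := by ring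
  have c4' : 3 * l + l = 4 * l := by ring
  have c6 : 3 * l + 3 * l = 6 * l := by ring
  simp only [c2, c4, c4', c6] at h
  have e1 : ∑ j ∈ Y, ∑ i ∈ X, s * n j * -m i * cauchyKernel (2 * l) (r j - A i) =
      - s * ∑ j ∈ Y, ∑ i ∈ X, n j * m i * cauchyKernel (2 * l) (A i - r j) := by
    simp only [Finset.mul_sum]
    refine Finset.sum_congr rfl fun j _ => Finset.sum_congr rfl fun i _ => ?_
    rw [cauchyKernel_sub_comm]; ring
  have e2 : ∑ i ∈ X, ∑ j ∈ Y, -m i * (s * n j) * cauchyKernel (2 * l) (A i - r j) =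
      - s * ∑ j ∈ Y, ∑ i ∈ X, n j * m i * cauchyKernel (2 * l) (A i - r j) := by
    rw [Finset.sum_comm]
    simp only [Finset.mul_sum]
    refine Finset.sum_congr rfl fun j _ => Finset.sum_congr rfl fun i _ => ?_
    ring
  have e3 : ∑ j ∈ Y, ∑ i ∈ X, s * n j * m i * cauchyKernel (4 * l) (r j - B i) =
      s * ∑ j ∈ Y, ∑ i ∈ X, n j * m i * cauchyKernel (4 * l) (B i - r j) := by
    simp only [Finset.mul_sum]
    refine Finset.sum_congr rfl fun j _ => Finset.sum_congr rfl fun i _ => ?_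
    rw [cauchyKernel_sub_comm]; ring
  have e4 : ∑ i ∈ X, ∑ j ∈ Y, m i * (s * n j) * cauchyKernel (4 * l) (B i - r j) =
      s * ∑ j ∈ Y, ∑ i ∈ X, n j * m i * cauchyKernel (4 * l) (B i - r j) := by
    rw [Finset.sum_comm]
    simp only [Finset.mul_sum]
    refine Finset.sum_congr rfl fun j _ => Finset.sum_congr rfl fun i _ => ?_
    ring
  have e5 : ∑ j ∈ Y, ∑ j' ∈ Y, s * n j * (s * n j') * cauchyKernel (2 * l) (r j - r j') =
      s ^ 2 * ∑ j ∈ Y, ∑ j' ∈ Y, n j * n j' * cauchyKernel (2 * l) (r j - r j') := by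
    simp only [Finset.mul_sum]
    refine Finset.sum_congr rfl fun j _ => Finset.sum_congr rfl fun i _ => ?_
    ring
  rw [e1, e2, e3, e4, e5] at h
  simp only [neg_mul, mul_neg, neg_neg, Finset.sum_neg_distrib] at h
  simp only [mul_sub, mul_add, Finset.sum_sub_distrib, Finset.sum_add_distrib]
  generalize ∑ j ∈ Y, ∑ i ∈ X, n j * m i * cauchyKernel (2 * l) (A i - r j) = P1 at *
  generalize ∑ j ∈ Y, ∑ i ∈ X, n j * m i * cauchyKernel (4 * l) (B i - r j) = P2 at *
  generalize ∑ j ∈ Y, ∑ j' ∈ Y, n j * n j' * cauchyKernel (2 * l) (r j - r j') = P3 at *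
  generalize ∑ i ∈ X, ∑ i' ∈ X, m i * m i' * cauchyKernel (2 * l) (A i - A i') = Q1 at *
  generalize ∑ i ∈ X, ∑ i' ∈ X, m i * m i' * cauchyKernel (6 * l) (B i - B i') = Q2 at *
  generalize ∑ i ∈ X, ∑ i' ∈ X, m i * m i' * cauchyKernel (4 * l) (A i - B i') = Q3 at *
  generalize ∑ i ∈ X, ∑ i' ∈ X, m i * m i' * cauchyKernel (4 * l) (B i - A i') = Q4 at *
  have key : 0 ≤ s⁻¹ * (s ^ 2 * P3 + s * (2 * P2 - 2 * P1) + (Q1 + Q2 - Q3 - Q4)) :=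
    mul_nonneg (by positivity) (by linarith)
  have e6 : s⁻¹ * (s ^ 2 * P3 + s * (2 * P2 - 2 * P1) + (Q1 + Q2 - Q3 - Q4)) =
      s * P3 + (2 * P2 - 2 * P1) + s⁻¹ * (Q1 + Q2 - Q3 - Q4) := by
    field_simp
  rw [e6] at key
  linarith

end Furstenberg

/-! ### Smoothed incidences: comparison of two consecutive scales -/

namespace Furstenberg

section Incidence

open MeasureTheory

lemma integrable_restrict_Ioc_of_continuous {f : ℝ → ℝ} (hf : Continuous f) (u v : ℝ) :
    Integrable f (volume.restrict (Set.Ioc u v)) :=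
  (hf.integrableOn_Icc (a := u) (b := v)).mono_set Set.Ioc_subset_Icc_self

lemma integral_indicator_mul_Ioc {f : ℝ → ℝ} {u v y l : ℝ} (hl : 0 ≤ l) (hu : u ≤ y - l)
    (hv : y ≤ v) :
    ∫ x in Set.Ioc u v, (Set.Ioc (y - l) y).indicator 1 x * f x = ∫ x in (y - l)..y, f x := by
  have h1 : ∀ x, (Set.Ioc (y - l) y).indicator 1 x * f x = (Set.Ioc (y - l) y).indicator f x := by
    intro x
    by_cases hx : x ∈ Set.Ioc (y - l) y <;> simp [hx]
  simp_rw [h1]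
  rw [setIntegral_indicator measurableSet_Ioc, intervalIntegral.integral_of_le (by linarith),
    Set.inter_eq_right.2 (Set.Ioc_subset_Ioc hu hv)]

lemma integrable_indicator_mul_Ioc {f : ℝ → ℝ} (hf : Continuous f) (u v y l : ℝ) :
    Integrable (fun x => (Set.Ioc (y - l) y).indicator 1 x * f x)
      (volume.restrict (Set.Ioc u v)) := by
  have h1 : (fun x => (Set.Ioc (y - l) y).indicator 1 x * f x) =
      (Set.Ioc (y - l) y).indicator f := by
    ext x
    by_cases hx : x ∈ Set.Ioc (y - l) y <;> simp [hx]
  rw [h1]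
  exact (integrable_restrict_Ioc_of_continuous hf u v).indicator measurableSet_Ioc

lemma indicator_mul_indicator_Ioc_eq_zero {y y' l : ℝ} (h : l < |y - y'|) (x : ℝ) :
    (Set.Ioc (y - l) y).indicator (1 : ℝ → ℝ) x * (Set.Ioc (y' - l) y').indicator 1 x = 0 := by
  by_cases hx : x ∈ Set.Ioc (y - l) y
  · by_cases hx' : x ∈ Set.Ioc (y' - l) y'
    · exfalso
      rw [Set.mem_Ioc] at hx hx'
      rcases lt_abs.1 h with h | h <;> linarith [hx.1, hx.2, hx'.1, hx'.2]
    · simp [hx']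
  · simp [hx]

lemma integrable_indicator_mul_indicator_Ioc (u v y y' l : ℝ) :
    Integrable (fun x => (Set.Ioc (y - l) y).indicator (1 : ℝ → ℝ) x *
      (Set.Ioc (y' - l) y').indicator 1 x) (volume.restrict (Set.Ioc u v)) := by
  have h1 : (fun x => (Set.Ioc (y - l) y).indicator (1 : ℝ → ℝ) x *
      (Set.Ioc (y' - l) y').indicator 1 x) =
      (Set.Ioc (y - l) y).indicator ((Set.Ioc (y' - l) y').indicator 1) := by
    ext x
    by_cases hx : x ∈ Set.Ioc (y - l) y <;> simp [hx]
  rw [h1]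
  exact ((integrable_restrict_Ioc_of_continuous continuous_one u v).indicator
    measurableSet_Ioc).indicator measurableSet_Ioc

lemma integral_indicator_mul_indicator_Ioc_le {u v y l : ℝ} (y' : ℝ) (hl : 0 ≤ l)
    (hu : u ≤ y - l) (hv : y ≤ v) :
    ∫ x in Set.Ioc u v, (Set.Ioc (y - l) y).indicator (1 : ℝ → ℝ) x *
      (Set.Ioc (y' - l) y').indicator 1 x ≤ if |y - y'| ≤ l then l else 0 := by
  split_ifs with h
  · have h1 : ∫ x in Set.Ioc u v, (Set.Ioc (y - l) y).indicator (1 : ℝ → ℝ) x *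
        (Set.Ioc (y' - l) y').indicator 1 x ≤
        ∫ x in Set.Ioc u v, (Set.Ioc (y - l) y).indicator (1 : ℝ → ℝ) x * 1 := by
      refine integral_mono (integrable_indicator_mul_indicator_Ioc u v y y' l)
        (integrable_indicator_mul_Ioc continuous_const u v y l) fun x => ?_
      refine mul_le_mul_of_nonneg_left ?_ (Set.indicator_nonneg (fun _ _ => zero_le_one) _)
      exact Set.indicator_le_self' (fun _ _ => zero_le_one) _
    refine h1.trans_eq ?_
    rw [integral_indicator_mul_Ioc (f := fun _ => 1) hl hu hv]
    simp
  · push Not at h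
    simp_rw [indicator_mul_indicator_Ioc_eq_zero h]
    simp

variable {ι κ : Type*} (X : Finset ι) (Y : Finset κ) (a b m : ι → ℝ) (θ r w : κ → ℝ)

/-- The Cauchy-smoothed incidence count between the weighted points `(a i, b i)` and the weighted
lines `(θ j, r j)`, at scale `Λ` and averaged over angles `θ j - h - [0, l]`. -/
noncomputable def smoothedIncidence (l Λ h : ℝ) : ℝ :=
  ∑ j ∈ Y, ∑ i ∈ X, w j * m i *
    (l⁻¹ * ∫ x in (θ j - l)..θ j, cauchyKernel Λ (angleForm (x - h) (a i) (b i) - r j))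

/-- The angular window of length `2l` splits into two of length `l`, the further one being the
nearer one shifted by `l`. Thus the comparison of scales only needs the shifts `h = 0` and `h = l`
on windows of a common length. -/
lemma smoothedIncidence_two_mul {l Λ : ℝ} (hΛ : 0 < Λ) :
    smoothedIncidence X Y a b m θ r w (2 * l) Λ 0 =
      (smoothedIncidence X Y a b m θ r w l Λ 0 + smoothedIncidence X Y a b m θ r w l Λ l) / 2 := by
  unfold smoothedIncidence
  rw [← Finset.sum_add_distrib, Finset.sum_div]
  refine Finset.sum_congr rfl fun j _ => ?_
  rw [← Finset.sum_add_distrib, Finset.sum_div]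
  refine Finset.sum_congr rfl fun i _ => ?_
  set f : ℝ → ℝ := fun x => cauchyKernel Λ (angleForm x (a i) (b i) - r j) with hf
  have hcont : Continuous f :=
    (continuous_cauchyKernel hΛ).comp ((continuous_angleForm _ _).sub continuous_const)
  have e1 : ∫ x in (θ j - l)..θ j, f (x - l) = ∫ x in (θ j - l - l)..(θ j - l), f x :=
    intervalIntegral.integral_comp_sub_right f l
  have e2 := intervalIntegral.integral_add_adjacent_intervals
    (hcont.intervalIntegrable (μ := volume) (θ j - l - l) (θ j - l))
    (hcont.intervalIntegrable (θ j - l) (θ j))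
  simp only [sub_zero]
  change w j * m i * ((2 * l)⁻¹ * ∫ x in (θ j - 2 * l)..θ j, f x) =
    (w j * m i * (l⁻¹ * ∫ x in (θ j - l)..θ j, f x) +
      w j * m i * (l⁻¹ * ∫ x in (θ j - l)..θ j, f (x - l))) / 2
  have e3 : θ j - 2 * l = θ j - l - l := by ring
  rw [e1, e3, ← e2, mul_inv]
  ring

lemma integral_add_sub_sub {ν : Measure ℝ} {f₁ f₂ f₃ f₄ : ℝ → ℝ} (h₁ : Integrable f₁ ν)
    (h₂ : Integrable f₂ ν) (h₃ : Integrable f₃ ν) (h₄ : Integrable f₄ ν) :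
    ∫ x, (f₁ x + f₂ x - f₃ x - f₄ x) ∂ν =
      ∫ x, f₁ x ∂ν + ∫ x, f₂ x ∂ν - ∫ x, f₃ x ∂ν - ∫ x, f₄ x ∂ν := by
  rw [integral_sub (f := fun x => f₁ x + f₂ x - f₃ x) ((h₁.add h₂).sub h₃) h₄,
    integral_sub (f := fun x => f₁ x + f₂ x) (h₁.add h₂) h₃, integral_add h₁ h₂]

/-- Shifting the angle by `h` rotates the point by `2πh`, so all four integrals have the closed form
`2 / √(Λ² + |·|²)` and the claim becomes the second-difference estimate. -/
lemma integral_point_terms_le {l h a b a' b' : ℝ} (hl : 0 < l) (h0 : 0 ≤ h) (hh : h ≤ l)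
    (hp : a ^ 2 + b ^ 2 ≤ 1) (hp' : a' ^ 2 + b' ^ 2 ≤ 1) :
    ∫ x in Set.Ioc (-1 : ℝ) 1, (cauchyKernel (2 * l) (angleForm x a b - angleForm x a' b') +
        cauchyKernel (6 * l) (angleForm (x - h) a b - angleForm (x - h) a' b')
        - cauchyKernel (4 * l) (angleForm x a b - angleForm (x - h) a' b')
        - cauchyKernel (4 * l) (angleForm (x - h) a b - angleForm x a' b')) ≤
      832 / l * (l / (l + max |a - a'| |b - b'|)) ^ 3 := by
  have hc : ∀ {Λ : ℝ}, 0 < Λ → ∀ α β : ℝ,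
      Integrable (fun x => cauchyKernel Λ (angleForm x α β))
        (volume.restrict (Set.Ioc (-1 : ℝ) 1)) := fun hΛ α β =>
    integrable_restrict_Ioc_of_continuous
      ((continuous_cauchyKernel hΛ).comp (continuous_angleForm α β)) _ _
  have hi : ∀ {Λ : ℝ}, 0 < Λ → ∀ α β : ℝ,
      ∫ x in Set.Ioc (-1 : ℝ) 1, cauchyKernel Λ (angleForm x α β) =
        2 / Real.sqrt (Λ ^ 2 + (α ^ 2 + β ^ 2)) := fun hΛ α β => by
    rw [← integral_cauchyKernel_angleForm hΛ, intervalIntegral.integral_of_le (by norm_num)]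
  have h2 : 0 < 2 * l := by positivity
  have h4 : 0 < 4 * l := by positivity
  have h6 : 0 < 6 * l := by positivity
  simp_rw [angleForm_sub _ h, angleForm_sub_angleForm]
  rw [integral_add_sub_sub (hc h2 _ _) (hc h6 _ _) (hc h4 _ _) (hc h4 _ _),
    hi h2, hi h6, hi h4, hi h4]
  set c := Real.cos (2 * Real.pi * h) with hcdef
  set s := Real.sin (2 * Real.pi * h) with hsdef
  have hcs : s ^ 2 + c ^ 2 = 1 := Real.sin_sq_add_cos_sq _
  set V := (a - a') ^ 2 + (b - b') ^ 2 with hV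
  set e := 2 * (1 - c) * (a * a' + b * b') with he
  set f := 2 * s * (a' * b - a * b') with hf
  have v6 : (a * c - b * s - (a' * c - b' * s)) ^ 2 +
      (a * s + b * c - (a' * s + b' * c)) ^ 2 = V := by
    rw [hV]; linear_combination ((a - a') ^ 2 + (b - b') ^ 2) * hcs
  have v4 : (a - (a' * c - b' * s)) ^ 2 + (b - (a' * s + b' * c)) ^ 2 = V + e - f := by
    rw [hV, he, hf]; linear_combination (a' ^ 2 + b' ^ 2) * hcs
  have v4' : (a * c - b * s - a') ^ 2 + (a * s + b * c - b') ^ 2 = V + e + f := by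
    rw [hV, he, hf]; linear_combination (a ^ 2 + b ^ 2) * hcs
  -- The bound is `2 (1 - cos 2πh) ≤ (2πh)² ≤ 40 l²`, with `π² ≤ 10` and inner product of the points
  -- at most `1`.
  have he40 : e ≤ 40 * l ^ 2 := by
    have hc1 : 1 - (2 * Real.pi * h) ^ 2 / 2 ≤ c := Real.one_sub_sq_div_two_le_cos
    have hc2 : c ≤ 1 := Real.cos_le_one _
    have hpi := Real.pi_lt_d2
    have hpi0 := Real.pi_pos
    have hpi2 : Real.pi ^ 2 ≤ 10 := by nlinarith
    have hh2 : h ^ 2 ≤ l ^ 2 := by gcongr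
    have h10 : Real.pi ^ 2 * h ^ 2 ≤ 10 * l ^ 2 := by gcongr
    have hdot : a * a' + b * b' ≤ 1 := by nlinarith [sq_nonneg (a - a'), sq_nonneg (b - b')]
    calc e ≤ 2 * (1 - c) * 1 := by
          rw [he]; exact mul_le_mul_of_nonneg_left hdot (by linarith)
      _ ≤ 40 * l ^ 2 := by nlinarith
  have hd : max |a - a'| |b - b'| ^ 2 ≤ V := by
    rcases max_choice |a - a'| |b - b'| with h | h <;> rw [h, sq_abs, hV]
    · exact le_add_of_nonneg_right (sq_nonneg _)
    · exact le_add_of_nonneg_left (sq_nonneg _)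
  have key := second_difference_le hl (le_max_of_le_left (abs_nonneg (a - a')))
    hd he40 (by rw [← v4]; positivity) (by rw [← v4']; positivity)
  rw [v6, v4, v4']
  have e1 : ∀ z : ℝ, 2 / z = 2 * (1 / z) := fun z => by ring
  have e2 : 832 / l * (l / (l + max |a - a'| |b - b'|)) ^ 3 =
    2 * (416 / l * (l / (l + max |a - a'| |b - b'|)) ^ 3) := by ring
  rw [e2, e1, e1, e1, e1]
  linarith

/-- The positivity inequality is applied at each angle `x`, a line being active only while `x ∈ (θ j
- l, θ j]`, and then integrated. Two lines are simultaneously active only if their angles differ by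
at most `l`, whereas the point terms are integrated over all angles. -/
lemma smoothedIncidence_sub_le {l h s : ℝ} (hl : 0 < l) (hl1 : l ≤ 1) (hs : 0 < s) (h0 : 0 ≤ h)
    (hh : h ≤ l) (hX : ∀ i ∈ X, a i ^ 2 + b i ^ 2 ≤ 1) (hm : ∀ i ∈ X, 0 ≤ m i)
    (hw : ∀ j ∈ Y, 0 ≤ w j) (hθ : ∀ j ∈ Y, θ j ∈ Set.Icc (0 : ℝ) 1) :
    2 * (smoothedIncidence X Y a b m θ r w l (2 * l) 0
        - smoothedIncidence X Y a b m θ r w l (4 * l) h) ≤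
      s * ∑ j ∈ Y, ∑ j' ∈ Y, w j * w j' *
        (if |θ j - θ j'| ≤ l then l⁻¹ * cauchyKernel (2 * l) (r j - r j') else 0) +
      s⁻¹ * ∑ i ∈ X, ∑ i' ∈ X, m i * m i' *
        (832 / l * (l / (l + max |a i - a i'| |b i - b i'|)) ^ 3) := by
  set J : κ → ℝ → ℝ := fun j => (Set.Ioc (θ j - l) (θ j)).indicator 1 with hJ
  set ν := volume.restrict (Set.Ioc (-1 : ℝ) 1) with hν
  have h2 : 0 < 2 * l := by positivity
  have h4 : 0 < 4 * l := by positivity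
  have h6 : 0 < 6 * l := by positivity
  have hcA : ∀ i, Continuous fun x => angleForm x (a i) (b i) := fun i => continuous_angleForm _ _
  have hcB : ∀ i, Continuous fun x => angleForm (x - h) (a i) (b i) := fun i =>
    (continuous_angleForm _ _).comp (by fun_prop)
  have hck : ∀ {Λ : ℝ}, 0 < Λ → ∀ {g : ℝ → ℝ}, Continuous g →
      Continuous fun x => cauchyKernel Λ (g x) := fun hΛ _ hg => (continuous_cauchyKernel hΛ).comp hg
  set Lf : κ → ι → ℝ → ℝ := fun j i x => cauchyKernel (2 * l) (angleForm x (a i) (b i) - r j) -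
    cauchyKernel (4 * l) (angleForm (x - h) (a i) (b i) - r j) with hLf
  have hLc : ∀ j i, Continuous (Lf j i) := fun j i =>
    (hck h2 ((hcA i).sub continuous_const)).sub (hck h4 ((hcB i).sub continuous_const))
  set Pf : ι → ι → ℝ → ℝ := fun i i' x =>
    cauchyKernel (2 * l) (angleForm x (a i) (b i) - angleForm x (a i') (b i')) +
      cauchyKernel (6 * l) (angleForm (x - h) (a i) (b i) - angleForm (x - h) (a i') (b i')) -
      cauchyKernel (4 * l) (angleForm x (a i) (b i) - angleForm (x - h) (a i') (b i')) -
      cauchyKernel (4 * l) (angleForm (x - h) (a i) (b i) - angleForm x (a i') (b i')) with hPf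
  have hPc : ∀ i i', Continuous (Pf i i') := fun i i' =>
    (((hck h2 ((hcA i).sub (hcA i'))).add (hck h6 ((hcB i).sub (hcB i')))).sub
      (hck h4 ((hcA i).sub (hcB i')))).sub (hck h4 ((hcB i).sub (hcA i')))
  have iL : ∀ j i, Integrable (fun x => w j * m i * l⁻¹ * (J j x * Lf j i x)) ν := fun j i =>
    (integrable_indicator_mul_Ioc (hLc j i) _ _ _ _).const_mul _
  have iN : ∀ j j', Integrable (fun x => w j * w j' * l⁻¹ ^ 2 *
      cauchyKernel (2 * l) (r j - r j') * (J j x * J j' x)) ν := fun j j' =>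
    (integrable_indicator_mul_indicator_Ioc _ _ _ _ _).const_mul _
  have iP : ∀ i i', Integrable (fun x => m i * m i' * Pf i i' x) ν := fun i i' =>
    (integrable_restrict_Ioc_of_continuous (hPc i i') _ _).const_mul _
  have sL : Integrable (fun x => ∑ j ∈ Y, ∑ i ∈ X, w j * m i * l⁻¹ * (J j x * Lf j i x)) ν :=
    integrable_finsetSum _ fun j _ => integrable_finsetSum _ fun i _ => iL j i
  have sN : Integrable (fun x => ∑ j ∈ Y, ∑ j' ∈ Y, w j * w j' * l⁻¹ ^ 2 *
      cauchyKernel (2 * l) (r j - r j') * (J j x * J j' x)) ν :=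
    integrable_finsetSum _ fun j _ => integrable_finsetSum _ fun i _ => iN j i
  have sP : Integrable (fun x => ∑ i ∈ X, ∑ i' ∈ X, m i * m i' * Pf i i' x) ν :=
    integrable_finsetSum _ fun j _ => integrable_finsetSum _ fun i _ => iP j i
  have hpt : ∀ x, 2 * (∑ j ∈ Y, ∑ i ∈ X, w j * m i * l⁻¹ * (J j x * Lf j i x)) ≤
      s * (∑ j ∈ Y, ∑ j' ∈ Y, w j * w j' * l⁻¹ ^ 2 *
        cauchyKernel (2 * l) (r j - r j') * (J j x * J j' x)) +
      s⁻¹ * ∑ i ∈ X, ∑ i' ∈ X, m i * m i' * Pf i i' x := by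
    intro x
    have key := cauchyKernel_pairing_le X Y m (fun i => angleForm x (a i) (b i))
      (fun i => angleForm (x - h) (a i) (b i)) (fun j => w j * (l⁻¹ * J j x)) r hl hs
    refine le_trans (le_of_eq ?_) (key.trans (le_of_eq ?_))
    · congr 1
      refine Finset.sum_congr rfl fun j _ => Finset.sum_congr rfl fun i _ => ?_
      simp only [hLf]; ring
    · congr 2
      refine Finset.sum_congr rfl fun j _ => Finset.sum_congr rfl fun i _ => ?_
      ring
  have hint := integral_mono (sL.const_mul 2) ((sN.const_mul s).add (sP.const_mul s⁻¹)) hpt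
  simp only [Pi.add_apply] at hint
  rw [integral_const_mul, integral_add (sN.const_mul s) (sP.const_mul s⁻¹), integral_const_mul,
    integral_const_mul] at hint
  have eL : ∫ x, ∑ j ∈ Y, ∑ i ∈ X, w j * m i * l⁻¹ * (J j x * Lf j i x) ∂ν =
      smoothedIncidence X Y a b m θ r w l (2 * l) 0
        - smoothedIncidence X Y a b m θ r w l (4 * l) h := by
    rw [integral_finsetSum _ fun j _ => integrable_finsetSum _ fun i _ => iL j i]
    unfold smoothedIncidence
    rw [← Finset.sum_sub_distrib]
    refine Finset.sum_congr rfl fun j hj => ?_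
    rw [integral_finsetSum _ fun i _ => iL j i, ← Finset.sum_sub_distrib]
    refine Finset.sum_congr rfl fun i _ => ?_
    rw [integral_const_mul, integral_indicator_mul_Ioc hl.le (by linarith [(hθ j hj).1])
      (hθ j hj).2, intervalIntegral.integral_sub]
    · simp only [sub_zero]; ring
    · exact (hck h2 ((hcA i).sub continuous_const)).intervalIntegrable _ _
    · exact (hck h4 ((hcB i).sub continuous_const)).intervalIntegrable _ _
  rw [eL] at hint
  refine hint.trans ?_
  gcongr ?_ * ?_ + ?_ * ?_
  · rw [integral_finsetSum _ fun j _ => integrable_finsetSum _ fun i _ => iN j i]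
    refine Finset.sum_le_sum fun j hj => ?_
    rw [integral_finsetSum _ fun j' _ => iN j j']
    refine Finset.sum_le_sum fun j' hj' => ?_
    rw [integral_const_mul]
    have hb := integral_indicator_mul_indicator_Ioc_le (θ j') hl.le
      (by linarith [(hθ j hj).1] : (-1 : ℝ) ≤ θ j - l) (hθ j hj).2
    have hk := cauchyKernel_nonneg h2.le (r j - r j')
    have hwj := hw j hj
    have hwj' := hw j' hj'
    refine (mul_le_mul_of_nonneg_left hb (by positivity)).trans (le_of_eq ?_)
    split_ifs
    · field_simp
    · simp
  · rw [integral_finsetSum _ fun j _ => integrable_finsetSum _ fun i _ => iP j i]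
    refine Finset.sum_le_sum fun i hi => ?_
    rw [integral_finsetSum _ fun i' _ => iP i i']
    refine Finset.sum_le_sum fun i' hi' => ?_
    rw [integral_const_mul]
    exact mul_le_mul_of_nonneg_left (integral_point_terms_le hl h0 hh (hX i hi) (hX i' hi'))
      (mul_nonneg (hm i hi) (hm i' hi'))

end Incidence

end Furstenberg

/-! ### The multiscale incidence theorem -/

namespace Furstenberg

section IncidenceBound

variable {ι κ : Type*} {X : Finset ι} {Y : Finset κ} {a b m : ι → ℝ} {θ r w : κ → ℝ}

/-- The restriction `|θ j - θ j'| ≤ l` converts the kernel, which decays only in `r`, into one with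
quadratic decay in the sup distance of the parameters. Growth of dimension `u < 2` makes this
summable. -/
lemma sum_line_terms_le {l u B : ℝ} (hl : 0 < l) (hB : 0 ≤ B) (hu : u < 2)
    (hw : ∀ j ∈ Y, 0 ≤ w j)
    (hν : ∀ j ∈ Y, ∀ k : ℕ, ∑ j' ∈ Y with max |θ j - θ j'| |r j - r j'| ≤ 2 ^ k * l, w j' ≤
      B * (2 ^ k * l) ^ u) :
    ∑ j ∈ Y, ∑ j' ∈ Y, w j * w j' *
        (if |θ j - θ j'| ≤ l then l⁻¹ * cauchyKernel (2 * l) (r j - r j') else 0) ≤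
      16 * (1 - (2 : ℝ) ^ (u - 2))⁻¹ * (B * ∑ j ∈ Y, w j) * l ^ (u - 2) := by
  have hj : ∀ j ∈ Y, ∑ j' ∈ Y, w j * w j' *
      (if |θ j - θ j'| ≤ l then l⁻¹ * cauchyKernel (2 * l) (r j - r j') else 0) ≤
      w j * (16 * (1 - (2 : ℝ) ^ (u - 2))⁻¹ * B * l ^ (u - 2)) := by
    intro j hj
    have h1 := sum_mul_decay_le Y w (fun j' => max |θ j - θ j'| |r j - r j'|) 2 hl hB hw
      (fun j' _ => le_max_of_le_left (abs_nonneg _)) (by exact_mod_cast hu) (hν j hj)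
    have h2 : ∀ j' ∈ Y, w j * w j' *
        (if |θ j - θ j'| ≤ l then l⁻¹ * cauchyKernel (2 * l) (r j - r j') else 0) ≤
        w j * (4 / l ^ 2) * (w j' * (l / (l + max |θ j - θ j'| |r j - r j'|)) ^ 2) := by
      intro j' hj'
      set d := max |θ j - θ j'| |r j - r j'| with hd
      have hd0 : 0 ≤ d := le_max_of_le_left (abs_nonneg _)
      have h3 : (if |θ j - θ j'| ≤ l then l⁻¹ * cauchyKernel (2 * l) (r j - r j') else 0) ≤
          4 / l ^ 2 * (l / (l + d)) ^ 2 := by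
        split_ifs with hc
        · have hdle : d ≤ l + |r j - r j'| :=
            max_le (hc.trans (by linarith [abs_nonneg (r j - r j')])) (by linarith)
          have h4 : (l + d) ^ 2 ≤ 2 * ((2 * l) ^ 2 + (r j - r j') ^ 2) := by
            rw [← sq_abs (r j - r j')]
            have : (l + d) ^ 2 ≤ (2 * l + |r j - r j'|) ^ 2 :=
              pow_le_pow_left₀ (by positivity) (by linarith) 2
            nlinarith [sq_nonneg (2 * l - |r j - r j'|)]
          unfold cauchyKernel
          calc l⁻¹ * (2 * l / ((2 * l) ^ 2 + (r j - r j') ^ 2))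
              = 4 / (2 * ((2 * l) ^ 2 + (r j - r j') ^ 2)) := by field_simp; norm_num
            _ ≤ 4 / (l + d) ^ 2 := by gcongr
            _ = 4 / l ^ 2 * (l / (l + d)) ^ 2 := by field_simp
        · positivity
      calc _ ≤ w j * w j' * (4 / l ^ 2 * (l / (l + d)) ^ 2) :=
            mul_le_mul_of_nonneg_left h3 (mul_nonneg (hw j hj) (hw j' hj'))
        _ = _ := by ring
    refine (Finset.sum_le_sum h2).trans ?_
    rw [← Finset.mul_sum]
    refine (mul_le_mul_of_nonneg_left h1
      (mul_nonneg (hw j hj) (by positivity : 0 ≤ 4 / l ^ 2))).trans (le_of_eq ?_)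
    rw [Real.rpow_sub hl, Real.rpow_two]
    push_cast
    field_simp
    ring
  refine (Finset.sum_le_sum hj).trans (le_of_eq ?_)
  rw [← Finset.sum_mul]
  ring

/-- Cubic decay against growth of dimension at most `2` gives a geometric ratio of at most `1 / 2`,
hence a constant free of `t`. -/
lemma sum_point_terms_le {l t C : ℝ} (hl : 0 < l) (hC : 0 ≤ C) (ht : t ≤ 2)
    (hm : ∀ i ∈ X, 0 ≤ m i)
    (hμ : ∀ i ∈ X, ∀ k : ℕ, ∑ i' ∈ X with max |a i - a i'| |b i - b i'| ≤ 2 ^ k * l, m i' ≤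
      C * (2 ^ k * l) ^ t) :
    ∑ i ∈ X, ∑ i' ∈ X, m i * m i' *
        (832 / l * (l / (l + max |a i - a i'| |b i - b i'|)) ^ 3) ≤
      13312 * (C * ∑ i ∈ X, m i) * l ^ (t - 1) := by
  have hi : ∀ i ∈ X, ∑ i' ∈ X, m i * m i' *
      (832 / l * (l / (l + max |a i - a i'| |b i - b i'|)) ^ 3) ≤
      m i * (13312 * C * l ^ (t - 1)) := by
    intro i hi
    have h1 := sum_mul_decay_le X m (fun i' => max |a i - a i'| |b i - b i'|) 3 hl hC hm
      (fun i' _ => le_max_of_le_left (abs_nonneg _)) (by push_cast; linarith) (hμ i hi)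
    have h2 : (2 : ℝ) ^ (t - (3 : ℕ)) ≤ 1 / 2 := by
      calc (2 : ℝ) ^ (t - (3 : ℕ)) ≤ 2 ^ (-1 : ℝ) :=
            Real.rpow_le_rpow_of_exponent_le one_le_two (by push_cast; linarith)
        _ = 1 / 2 := by rw [Real.rpow_neg_one]; norm_num
    have h3 : (1 - (2 : ℝ) ^ (t - (3 : ℕ)))⁻¹ ≤ 2 := by
      generalize (2 : ℝ) ^ (t - (3 : ℕ)) = z at h2
      rw [inv_le_comm₀ (by linarith) two_pos]; linarith
    calc _ = m i * (832 / l) * ∑ i' ∈ X, m i' * (l / (l + max |a i - a i'| |b i - b i'|)) ^ 3 := by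
          rw [Finset.mul_sum]
          exact Finset.sum_congr rfl fun _ _ => by ring
      _ ≤ m i * (832 / l) * (2 ^ 3 * 2 * (C * l ^ t)) := by
          refine mul_le_mul_of_nonneg_left (h1.trans ?_) (mul_nonneg (hm i hi) (by positivity))
          gcongr
      _ = _ := by
          rw [Real.rpow_sub hl, Real.rpow_one]; ring
  refine (Finset.sum_le_sum hi).trans (le_of_eq ?_)
  rw [← Finset.sum_mul]
  ring

lemma smoothedIncidence_one_le (hm : ∀ i ∈ X, 0 ≤ m i) (hw : ∀ j ∈ Y, 0 ≤ w j) :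
    smoothedIncidence X Y a b m θ r w 1 2 0 ≤ (∑ i ∈ X, m i) * ∑ j ∈ Y, w j := by
  unfold smoothedIncidence
  rw [mul_comm, Finset.sum_mul_sum]
  refine Finset.sum_le_sum fun j hj => Finset.sum_le_sum fun i hi => ?_
  refine mul_le_of_le_one_right (mul_nonneg (hw j hj) (hm i hi)) ?_
  rw [inv_one, one_mul]
  have h1 : ∫ x in (θ j - 1)..θ j, cauchyKernel 2 (angleForm (x - 0) (a i) (b i) - r j) ≤
      ∫ _x in (θ j - 1)..θ j, (1 : ℝ) := by
    refine intervalIntegral.integral_mono (by linarith) ?_ (by simp) fun x => ?_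
    · exact ((continuous_cauchyKernel two_pos).comp (((continuous_angleForm _ _).comp
        (by fun_prop)).sub continuous_const)).intervalIntegrable _ _
    · unfold cauchyKernel
      rw [div_le_one (by positivity)]
      nlinarith [sq_nonneg (angleForm (x - 0) (a i) (b i) - r j)]
  simpa using h1

lemma smoothedIncidence_sub_two_mul_le {l t u C B : ℝ} (hl : 0 < l) (hl1 : l ≤ 1) (ht : t ≤ 2)
    (hu : u < 2) (hC : 0 < C) (hB : 0 < B)
    (hX : ∀ i ∈ X, a i ^ 2 + b i ^ 2 ≤ 1) (hm : ∀ i ∈ X, 0 ≤ m i)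
    (hw : ∀ j ∈ Y, 0 ≤ w j) (hθ : ∀ j ∈ Y, θ j ∈ Set.Icc (0 : ℝ) 1)
    (hμ : ∀ i ∈ X, ∀ k : ℕ, ∑ i' ∈ X with max |a i - a i'| |b i - b i'| ≤ 2 ^ k * l, m i' ≤
      C * (2 ^ k * l) ^ t)
    (hν : ∀ j ∈ Y, ∀ k : ℕ, ∑ j' ∈ Y with max |θ j - θ j'| |r j - r j'| ≤ 2 ^ k * l, w j' ≤
      B * (2 ^ k * l) ^ u) (hM : 0 < ∑ i ∈ X, m i) (hW : 0 < ∑ j ∈ Y, w j) :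
    smoothedIncidence X Y a b m θ r w l (2 * l) 0
        - smoothedIncidence X Y a b m θ r w (2 * l) (2 * (2 * l)) 0 ≤
      (8 * (1 - (2 : ℝ) ^ (u - 2))⁻¹ + 6656) *
        Real.sqrt (C * B * (∑ i ∈ X, m i) * ∑ j ∈ Y, w j) * l ^ ((t + u - 3) / 2) := by
  have hL := sum_line_terms_le hl hB.le hu hw hν
  have hP := sum_point_terms_le hl hC.le ht hm hμ
  set M := ∑ i ∈ X, m i
  set W := ∑ j ∈ Y, w j
  set D := Real.sqrt (C * B * M * W) with hD
  have hDpos : 0 < D := Real.sqrt_pos.2 (by positivity)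
  have hD2 : D ^ 2 = C * B * M * W := Real.sq_sqrt (by positivity)
  -- This choice balances the two energies: both become multiples of `D * l ^ ((t + u - 3) / 2)`.
  set s := D / (B * W) * l ^ ((t + 1 - u) / 2) with hs
  have hspos : 0 < s := by positivity
  have h1 := smoothedIncidence_sub_le X Y a b m θ r w hl hl1 hspos le_rfl hl.le hX hm hw hθ
  have h2 := smoothedIncidence_sub_le X Y a b m θ r w hl hl1 hspos hl.le le_rfl hX hm hw hθ
  have e1 : (2 : ℝ) * (2 * l) = 4 * l := by ring
  rw [smoothedIncidence_two_mul X Y a b m θ r w (by positivity : (0 : ℝ) < 2 * (2 * l)), e1]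
  set c := (1 - (2 : ℝ) ^ (u - 2))⁻¹
  have e2 : s * (16 * c * (B * W) * l ^ (u - 2)) = 16 * c * D * l ^ ((t + u - 3) / 2) := by
    have : l ^ ((t + u - 3) / 2) = l ^ ((t + 1 - u) / 2) * l ^ (u - 2) := by
      rw [← Real.rpow_add hl]; congr 1; ring
    rw [this, hs]
    field_simp
  have e3 : s⁻¹ * (13312 * (C * M) * l ^ (t - 1)) = 13312 * D * l ^ ((t + u - 3) / 2) := by
    have : l ^ (t - 1) = l ^ ((t + 1 - u) / 2) * l ^ ((t + u - 3) / 2) := by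
      rw [← Real.rpow_add hl]; congr 1; ring
    rw [this, hs]
    field_simp
    linear_combination -hD2
  have h3 := mul_le_mul_of_nonneg_left hL hspos.le
  have h4 := mul_le_mul_of_nonneg_left hP (inv_pos.2 hspos).le
  rw [e2] at h3
  rw [e3] at h4
  linarith

/-- Incidence estimate for a `t`-dimensional weight on points and a `u`-dimensional weight on
lines, `t + u > 3`. -/
theorem smoothedIncidence_le {t u C B : ℝ} (n : ℕ) (ht : t ≤ 2)
    (hu : u < 2) (htu : 3 < t + u) (hC : 0 < C) (hB : 0 < B)
    (hX : ∀ i ∈ X, a i ^ 2 + b i ^ 2 ≤ 1) (hm : ∀ i ∈ X, 0 ≤ m i)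
    (hw : ∀ j ∈ Y, 0 ≤ w j) (hθ : ∀ j ∈ Y, θ j ∈ Set.Icc (0 : ℝ) 1)
    (hμ : ∀ i ∈ X, ∀ k : ℕ, ∑ i' ∈ X with max |a i - a i'| |b i - b i'| ≤ 2 ^ k * (1 / 2) ^ n,
      m i' ≤ C * (2 ^ k * (1 / 2) ^ n) ^ t)
    (hν : ∀ j ∈ Y, ∀ k : ℕ, ∑ j' ∈ Y with max |θ j - θ j'| |r j - r j'| ≤ 2 ^ k * (1 / 2) ^ n,
      w j' ≤ B * (2 ^ k * (1 / 2) ^ n) ^ u) (hM : 0 < ∑ i ∈ X, m i) (hW : 0 < ∑ j ∈ Y, w j) :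
    smoothedIncidence X Y a b m θ r w ((1 / 2) ^ n) (2 * (1 / 2) ^ n) 0 ≤
      (∑ i ∈ X, m i) * (∑ j ∈ Y, w j) +
      (8 * (1 - (2 : ℝ) ^ (u - 2))⁻¹ + 6656) * (1 - (1 / 2 : ℝ) ^ ((t + u - 3) / 2))⁻¹ *
        Real.sqrt (C * B * (∑ i ∈ X, m i) * ∑ j ∈ Y, w j) := by
  set A := 8 * (1 - (2 : ℝ) ^ (u - 2))⁻¹ + 6656 with hA
  set D := Real.sqrt (C * B * (∑ i ∈ X, m i) * ∑ j ∈ Y, w j) with hD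
  set x := (1 / 2 : ℝ) ^ ((t + u - 3) / 2) with hx
  have hx0 : 0 < x := by positivity
  have hx1 : x < 1 := Real.rpow_lt_one (by norm_num) (by norm_num) (by linarith)
  have hu2 : (2 : ℝ) ^ (u - 2) < 1 := Real.rpow_lt_one_of_one_lt_of_neg one_lt_two (by linarith)
  have hA0 : 0 ≤ A := by
    have : 0 ≤ (1 - (2 : ℝ) ^ (u - 2))⁻¹ := inv_nonneg.2 (by linarith)
    positivity
  have hD0 : 0 ≤ D := Real.sqrt_nonneg _
  -- Telescoping from the unit scale, where the count is trivially at most the product of the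
  -- masses.
  have key : ∀ i ≤ n, smoothedIncidence X Y a b m θ r w ((1 / 2) ^ i) (2 * (1 / 2) ^ i) 0 ≤
      (∑ i ∈ X, m i) * (∑ j ∈ Y, w j) + A * D * ∑ k ∈ Finset.range i, x ^ (k + 1) := by
    intro i
    induction i with
    | zero => intro _; simpa using smoothedIncidence_one_le hm hw
    | succ i ih =>
      intro hi
      have h1 := ih (by omega)
      -- Every coarser dyadic radius is also a power of two times the finest scale, so the growth
      -- hypotheses at scale `(1 / 2) ^ n` serve all the scales.
      have e1 : ∀ k : ℕ, (2 : ℝ) ^ k * (1 / 2) ^ (i + 1) = 2 ^ (k + (n - (i + 1))) * (1 / 2) ^ n := by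
        intro k
        rw [pow_add 2 k, mul_assoc]
        congr 1
        rw [one_div, inv_pow, inv_pow]
        rw [eq_mul_inv_iff_mul_eq₀ (by positivity), inv_mul_eq_iff_eq_mul₀ (by positivity),
          ← pow_add]
        congr 1
        omega
      have h2 := smoothedIncidence_sub_two_mul_le (l := (1 / 2) ^ (i + 1)) (by positivity)
        (pow_le_one₀ (by norm_num) (by norm_num)) ht hu hC hB hX hm hw hθ
        (fun i' hi' k => by rw [e1]; exact hμ i' hi' _)
        (fun j hj k => by rw [e1]; exact hν j hj _) hM hW
      have e2 : (2 : ℝ) * (1 / 2) ^ (i + 1) = (1 / 2) ^ i := by rw [pow_succ]; ring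
      have e3 : ((1 / 2 : ℝ) ^ (i + 1)) ^ ((t + u - 3) / 2) = x ^ (i + 1) := by
        rw [hx, ← Real.rpow_natCast, ← Real.rpow_mul (by norm_num), mul_comm,
          Real.rpow_mul (by norm_num), Real.rpow_natCast]
      rw [e3, e2] at h2
      rw [e2, Finset.sum_range_succ]
      linarith
  refine (key n le_rfl).trans ?_
  have hg : ∑ k ∈ Finset.range n, x ^ (k + 1) ≤ (1 - x)⁻¹ := by
    have h1 : ∑ k ∈ Finset.range n, x ^ (k + 1) ≤ ∑ k ∈ Finset.range n, x ^ k :=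
      Finset.sum_le_sum fun k _ => pow_le_pow_of_le_one hx0.le hx1.le (by omega)
    have h2 := geom_sum_Ico_le_of_lt_one (m := 0) (n := n) hx0.le hx1
    rw [← Finset.range_eq_Ico, pow_zero, one_div] at h2
    exact h1.trans h2
  have := mul_le_mul_of_nonneg_left hg (mul_nonneg hA0 hD0)
  linarith

end IncidenceBound

end Furstenberg

/-! ### Dyadic cells, maximal spread subsets and saturated cells -/

namespace Furstenberg

section DyadicCells

/-- The index of the dyadic square `i` generations above the one with index `k`. -/
def ancestor (i : ℕ) (k : Fin 2 → ℤ) : Fin 2 → ℤ := fun a => k a / 2 ^ i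

lemma ancestor_apply_le (i : ℕ) (k : Fin 2 → ℤ) (a : Fin 2) :
    (2 : ℝ) ^ i * (ancestor i k a : ℝ) ≤ k a := by
  have h := Int.mul_ediv_self_le (x := k a) (k := 2 ^ i) (by positivity)
  unfold ancestor
  exact_mod_cast h

lemma lt_ancestor_apply (i : ℕ) (k : Fin 2 → ℤ) (a : Fin 2) :
    (k a : ℝ) < (2 : ℝ) ^ i * (ancestor i k a : ℝ) + 2 ^ i := by
  have h := Int.lt_mul_ediv_self_add (x := k a) (k := 2 ^ i) (by positivity)
  unfold ancestor
  exact_mod_cast h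

lemma ancestor_apply_eq_floor (i : ℕ) (k : Fin 2 → ℤ) (a : Fin 2) :
    ancestor i k a = ⌊(k a : ℝ) / 2 ^ i⌋ := by
  have h1 := ancestor_apply_le i k a
  have h2 := lt_ancestor_apply i k a
  symm
  rw [Int.floor_eq_iff, le_div_iff₀ (by positivity), div_lt_iff₀ (by positivity)]
  constructor <;> linarith

lemma card_le_of_ancestor_mem {X L : Finset (Fin 2 → ℤ)} {i : ℕ} {N : ℝ}
    (h : ∀ l, ((X.filter fun k => ancestor i k = l).card : ℝ) ≤ N)
    (hL : ∀ k ∈ X, ancestor i k ∈ L) : (X.card : ℝ) ≤ L.card * N := by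
  rw [Finset.card_eq_sum_card_fiberwise (f := ancestor i) (t := L) (by simpa [Set.MapsTo] using hL)]
  push_cast
  calc _ ≤ ∑ _l ∈ L, N := Finset.sum_le_sum fun l _ => h l
    _ = _ := by simp

/-- A box of radius `2 ^ i` touches at most three generation-`i` cells in each coordinate. -/
lemma card_box_le {X : Finset (Fin 2 → ℤ)} {i : ℕ} {N : ℝ}
    (h : ∀ l, ((X.filter fun k => ancestor i k = l).card : ℝ) ≤ N) (y : Fin 2 → ℝ) :
    ((X.filter fun k => ∀ a, |(k a : ℝ) - y a| ≤ 2 ^ i).card : ℝ) ≤ 9 * N := by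
  set L := Fintype.piFinset fun a => Finset.Icc (⌊y a / 2 ^ i⌋ - 1) (⌊y a / 2 ^ i⌋ + 1) with hL
  have hcard : (L.card : ℝ) = 9 := by
    rw [hL, Fintype.card_piFinset]
    have : ∀ z : ℤ, (Finset.Icc (z - 1) (z + 1)).card = 3 := fun z => by
      rw [Int.card_Icc]; omega
    simp [this]
  rw [← hcard]
  refine card_le_of_ancestor_mem (i := i) (fun l => ?_) fun k hk => ?_
  · refine le_trans ?_ (h l)
    exact_mod_cast Finset.card_le_card (Finset.filter_subset_filter _ (Finset.filter_subset _ _))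
  · rw [hL, Fintype.mem_piFinset]
    intro a
    have hka := abs_le.1 ((Finset.mem_filter.1 hk).2 a)
    rw [Finset.mem_Icc, ancestor_apply_eq_floor]
    have h2 : (0 : ℝ) < 2 ^ i := by positivity
    constructor
    · rw [← Int.floor_sub_one]
      refine Int.floor_le_floor ?_
      rw [div_sub_one h2.ne']
      gcongr
      linarith
    · rw [← Int.floor_add_one]
      refine Int.floor_le_floor ?_
      rw [div_add_one h2.ne']
      gcongr
      linarith

/-- Take an admissible subset of largest cardinality. A cell of `S` left out could only be excluded
because some ancestor would overflow, and as the allowance is at least `1`, a count `N` with `N + 1`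
above the allowance has `2 N` at least the allowance. A cell already in `S'` saturates its own
generation `0`. -/
lemma exists_maximal_spread_subset (S : Finset (Fin 2 → ℤ)) (n : ℕ) {u : ℝ} (hu : 0 ≤ u) :
    ∃ S' ⊆ S, (∀ i ≤ n, ∀ l, ((S'.filter fun k => ancestor i k = l).card : ℝ) ≤ ((2 : ℝ) ^ i) ^ u) ∧
      ∀ k ∈ S, ∃ i ≤ n, ((2 : ℝ) ^ i) ^ u ≤
        2 * ((S'.filter fun k' => ancestor i k' = ancestor i k).card : ℝ) := by
  classical
  set 𝒮 := S.powerset.filter fun S' =>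
    ∀ i ≤ n, ∀ l, ((S'.filter fun k => ancestor i k = l).card : ℝ) ≤ ((2 : ℝ) ^ i) ^ u with h𝒮
  have hone : ∀ i : ℕ, (1 : ℝ) ≤ ((2 : ℝ) ^ i) ^ u := fun i =>
    Real.one_le_rpow (one_le_pow₀ one_le_two) hu
  obtain ⟨S', hS', hmax⟩ := Finset.exists_max_image 𝒮 Finset.card
    ⟨∅, by simp only [h𝒮, Finset.mem_filter, Finset.empty_mem_powerset, true_and,
      Finset.filter_empty, Finset.card_empty]; intro i _ _; push_cast; linarith [hone i]⟩
  rw [h𝒮, Finset.mem_filter, Finset.mem_powerset] at hS'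
  refine ⟨S', hS'.1, hS'.2, fun k hk => ?_⟩
  by_cases hkS : k ∈ S'
  · refine ⟨0, n.zero_le, ?_⟩
    have h1 : 1 ≤ (S'.filter fun k' => ancestor 0 k' = ancestor 0 k).card :=
      Finset.card_pos.2 ⟨k, by simp [hkS]⟩
    have h2 : (1 : ℝ) ≤ ((S'.filter fun k' => ancestor 0 k' = ancestor 0 k).card : ℝ) := by
      exact_mod_cast h1
    rw [pow_zero, Real.one_rpow]
    linarith
  · have hnot : insert k S' ∉ 𝒮 := fun hmem => by
      have := hmax _ hmem
      rw [Finset.card_insert_of_notMem hkS] at this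
      omega
    rw [h𝒮, Finset.mem_filter, Finset.mem_powerset] at hnot
    have hsub : insert k S' ⊆ S := Finset.insert_subset hk hS'.1
    simp only [hsub, true_and, not_forall, not_le] at hnot
    obtain ⟨i, hi, l, hl⟩ := hnot
    refine ⟨i, hi, ?_⟩
    rw [Finset.filter_insert] at hl
    split_ifs at hl with hkl
    · rw [Finset.card_insert_of_notMem (by simp [hkS])] at hl
      rw [hkl]
      push_cast at hl
      have h1 := hone i
      have h2 : 1 ≤ (S'.filter fun k' => ancestor i k' = l).card := by
        have : (0 : ℝ) < ((S'.filter fun k' => ancestor i k' = l).card : ℝ) := by linarith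
        exact_mod_cast this
      have h3 : (1 : ℝ) ≤ ((S'.filter fun k' => ancestor i k' = l).card : ℝ) := by exact_mod_cast h2
      linarith
    · exact absurd (hS'.2 i hi l) (not_le.2 hl)

/-- The dyadic cells of generation `i` that contain at least half the number of points of `S'`
allowed by `u`-dimensional growth. -/
noncomputable def saturatedCells (S' : Finset (Fin 2 → ℤ)) (u : ℝ) (i : ℕ) :
    Finset (Fin 2 → ℤ) := by
  classical
  exact (S'.image (ancestor i)).filter fun l =>
    ((2 : ℝ) ^ i) ^ u ≤ 2 * ((S'.filter fun k => ancestor i k = l).card : ℝ)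

lemma mem_saturatedCells {S' : Finset (Fin 2 → ℤ)} {u : ℝ} {i : ℕ} {l : Fin 2 → ℤ} :
    l ∈ saturatedCells S' u i ↔ (∃ k ∈ S', ancestor i k = l) ∧
      ((2 : ℝ) ^ i) ^ u ≤ 2 * ((S'.filter fun k => ancestor i k = l).card : ℝ) := by
  classical
  simp [saturatedCells]

lemma mem_saturatedCells_of_le {S' : Finset (Fin 2 → ℤ)} {u : ℝ} {i : ℕ} {l : Fin 2 → ℤ}
    (h : ((2 : ℝ) ^ i) ^ u ≤ 2 * ((S'.filter fun k => ancestor i k = l).card : ℝ)) :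
    l ∈ saturatedCells S' u i := by
  refine mem_saturatedCells.2 ⟨?_, h⟩
  have h1 : (0 : ℝ) < ((2 : ℝ) ^ i) ^ u := by positivity
  have h2 : (0 : ℝ) < ((S'.filter fun k => ancestor i k = l).card : ℝ) := by linarith
  obtain ⟨k, hk⟩ := Finset.card_pos.1 (by exact_mod_cast h2)
  exact ⟨k, (Finset.mem_filter.1 hk).1, (Finset.mem_filter.1 hk).2⟩

/-- Distinct cells of one generation have disjoint sets of descendants, so the half-full counts add
up. -/
lemma card_mul_le_of_subset_saturatedCells {S' L : Finset (Fin 2 → ℤ)} {u : ℝ} {i : ℕ}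
    (hL : L ⊆ saturatedCells S' u i) :
    (L.card : ℝ) * ((2 : ℝ) ^ i) ^ u ≤ 2 * ((S'.filter fun k => ancestor i k ∈ L).card : ℝ) := by
  rw [Finset.card_eq_sum_card_fiberwise (s := S'.filter fun k => ancestor i k ∈ L)
    (f := ancestor i) (t := L) (fun k hk => (Finset.mem_filter.1 hk).2)]
  push_cast
  rw [Finset.mul_sum, ← nsmul_eq_mul, ← Finset.sum_const]
  refine Finset.sum_le_sum fun l hl => (mem_saturatedCells.1 (hL hl)).2.trans_eq ?_
  rw [Finset.filter_filter]
  congr 3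
  ext k
  simp only [Finset.mem_filter]
  constructor
  · rintro ⟨h1, h2⟩; exact ⟨h1, h2 ▸ hl, h2⟩
  · rintro ⟨h1, -, h2⟩; exact ⟨h1, h2⟩

lemma card_saturatedCells_mul_le (S' : Finset (Fin 2 → ℤ)) (u : ℝ) (i : ℕ) :
    ((saturatedCells S' u i).card : ℝ) * ((2 : ℝ) ^ i) ^ u ≤ 2 * (S'.card : ℝ) := by
  refine (card_mul_le_of_subset_saturatedCells subset_rfl).trans ?_
  gcongr
  exact Finset.filter_subset _ _

/-- Beyond generation `n` there is no hypothesis, but the cells considered lie under only nine cells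
of generation `n`: one in angle and those of index `-4` to `4` in `r`. -/
lemma card_box_le_of_spread {S' : Finset (Fin 2 → ℤ)} {n : ℕ} {u : ℝ} (hu : 0 ≤ u)
    (h : ∀ i ≤ n, ∀ l, ((S'.filter fun k => ancestor i k = l).card : ℝ) ≤ ((2 : ℝ) ^ i) ^ u)
    (h0 : ∀ k ∈ S', 0 ≤ k 0 ∧ k 0 < 2 ^ n) (h1 : ∀ k ∈ S', |k 1| ≤ 4 * 2 ^ n)
    (i : ℕ) (y : Fin 2 → ℝ) :
    ((S'.filter fun k => ∀ a, |(k a : ℝ) - y a| ≤ 2 ^ i).card : ℝ) ≤ 9 * ((2 : ℝ) ^ i) ^ u := by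
  rcases le_total i n with hin | hin
  · exact card_box_le (h i hin) y
  · have h2 : ((S'.filter fun k => ∀ a, |(k a : ℝ) - y a| ≤ 2 ^ i).card : ℝ) ≤ S'.card := by
      exact_mod_cast Finset.card_le_card (Finset.filter_subset _ _)
    set L : Finset (Fin 2 → ℤ) := Fintype.piFinset
      fun a => if a = 0 then {0} else Finset.Icc (-4) 4 with hL
    have hcard : (L.card : ℝ) = 9 := by
      rw [hL, Fintype.card_piFinset]; simp
    have h3 := card_le_of_ancestor_mem (L := L) (h n le_rfl) fun k hk => by
      rw [hL, Fintype.mem_piFinset]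
      intro a
      have hp : (0 : ℤ) < 2 ^ n := by positivity
      fin_cases a
      · simpa [ancestor] using Int.ediv_eq_zero_of_lt (h0 k hk).1 (h0 k hk).2
      · have := abs_le.1 (h1 k hk)
        simp only [ancestor, Fin.mk_one, Fin.isValue, one_ne_zero, ↓reduceIte, Finset.mem_Icc]
        exact ⟨by rw [Int.le_ediv_iff_mul_le hp]; linarith,
          (Int.ediv_le_iff_le_mul hp).2 (by linarith)⟩
    rw [hcard] at h3
    refine h2.trans (h3.trans ?_)
    gcongr
    exact one_le_two

/-- Saturation transfers the spread of `S'` to the coarse cells: their descendants lie in a box of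
radius `2 ^ (i + j + 1)`. The constant is `72 = 2 * 9 * 4`, from half-fullness, the box bound, and
the extra factor `2 ^ u ≤ 4`. -/
lemma card_saturatedCells_box_le {S' : Finset (Fin 2 → ℤ)} {u : ℝ} (hu2 : u ≤ 2)
    (h : ∀ (i : ℕ) (y : Fin 2 → ℝ),
      ((S'.filter fun k => ∀ a, |(k a : ℝ) - y a| ≤ 2 ^ i).card : ℝ) ≤ 9 * ((2 : ℝ) ^ i) ^ u)
    (i j : ℕ) (y : Fin 2 → ℝ) :
    (((saturatedCells S' u i).filter fun l => ∀ a, |(l a : ℝ) - y a| ≤ 2 ^ j).card : ℝ) ≤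
      72 * ((2 : ℝ) ^ j) ^ u := by
  have h1 := card_mul_le_of_subset_saturatedCells (S' := S') (u := u) (i := i)
    (Finset.filter_subset (fun l => ∀ a, |(l a : ℝ) - y a| ≤ 2 ^ j) (saturatedCells S' u i))
  have h2 := h (i + j + 1) fun a => 2 ^ i * y a
  have h3 : ((S'.filter fun k => ancestor i k ∈
      (saturatedCells S' u i).filter fun l => ∀ a, |(l a : ℝ) - y a| ≤ 2 ^ j).card : ℝ) ≤
      ((S'.filter fun k => ∀ a, |(k a : ℝ) - 2 ^ i * y a| ≤ 2 ^ (i + j + 1)).card : ℝ) := by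
    have : (S'.filter fun k => ancestor i k ∈
      (saturatedCells S' u i).filter fun l => ∀ a, |(l a : ℝ) - y a| ≤ 2 ^ j) ⊆
      (S'.filter fun k => ∀ a, |(k a : ℝ) - 2 ^ i * y a| ≤ 2 ^ (i + j + 1)) := by
      intro k hk
      rw [Finset.mem_filter, Finset.mem_filter] at hk
      refine Finset.mem_filter.2 ⟨hk.1, fun a => ?_⟩
      have ha := abs_le.1 (hk.2.2 a)
      have l1 := ancestor_apply_le i k a
      have l2 := lt_ancestor_apply i k a
      have hp : (0 : ℝ) < 2 ^ i := by positivity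
      have hj : (1 : ℝ) ≤ 2 ^ j := one_le_pow₀ one_le_two
      have e : (2 : ℝ) ^ (i + j + 1) = 2 ^ i * 2 ^ j + 2 ^ i * 2 ^ j := by
        rw [pow_succ, pow_add]; ring
      rw [e, abs_le]
      constructor <;> nlinarith
    exact_mod_cast Finset.card_le_card this
  have hp : (0 : ℝ) < ((2 : ℝ) ^ i) ^ u := by positivity
  have h4 : ((2 : ℝ) ^ (i + j + 1)) ^ u ≤ ((2 : ℝ) ^ i) ^ u * (((2 : ℝ) ^ j) ^ u * 4) := by
    rw [add_assoc, pow_add, Real.mul_rpow (by positivity) (by positivity), pow_succ,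
      Real.mul_rpow (by positivity) (by positivity)]
    gcongr
    calc (2 : ℝ) ^ u ≤ 2 ^ (2 : ℝ) := Real.rpow_le_rpow_of_exponent_le one_le_two hu2
      _ = 4 := by norm_num
  refine le_of_mul_le_mul_right ?_ hp
  calc _ ≤ 2 * (9 * ((2 : ℝ) ^ (i + j + 1)) ^ u) :=
        h1.trans (mul_le_mul_of_nonneg_left (h3.trans h2) zero_le_two)
    _ ≤ 2 * (9 * (((2 : ℝ) ^ i) ^ u * (((2 : ℝ) ^ j) ^ u * 4))) := by gcongr
    _ = _ := by ring

end DyadicCells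

end Furstenberg

/-! ### Covering numbers, squares and elementary projection estimates -/

namespace Furstenberg

section CoveringNumbers

variable {X : Type*} [MetricSpace X] {δ : ℝ}

lemma covNum_mono {A B : Set X} (h : A ⊆ B) : covNum δ A ≤ covNum δ B := by
  unfold covNum
  exact_mod_cast Metric.externalCoveringNumber_mono_set h

lemma exists_isCover_encard_eq (ε : NNReal) (A : Set X) :
    ∃ N, Metric.IsCover ε A N ∧ N.encard = Metric.externalCoveringNumber ε A := by
  have : Nonempty {N // Metric.IsCover ε A N} := ⟨⟨A, Metric.IsCover.rfl⟩⟩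
  obtain ⟨N, hN⟩ := ciInf_mem fun N : {N // Metric.IsCover ε A N} => (N : Set X).encard
  refine ⟨N, N.2, ?_⟩
  rw [Metric.externalCoveringNumber, iInf_subtype']
  exact hN

lemma covNum_union_le (A B : Set X) : covNum δ (A ∪ B) ≤ covNum δ A + covNum δ B := by
  obtain ⟨N, hN, hN'⟩ := exists_isCover_encard_eq δ.toNNReal A
  obtain ⟨P, hP, hP'⟩ := exists_isCover_encard_eq δ.toNNReal B
  have h : Metric.IsCover δ.toNNReal (A ∪ B) (N ∪ P) := by
    rw [Metric.isCover_iff_subset_iUnion_closedBall] at *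
    rw [Set.biUnion_union]
    exact Set.union_subset_union hN hP
  have h2 := h.externalCoveringNumber_le_encard.trans (Set.encard_union_le N P)
  rw [hN', hP'] at h2
  unfold covNum
  exact_mod_cast h2

lemma covNum_empty : covNum δ (∅ : Set X) = 0 := by
  simp [covNum]

lemma covNum_biUnion_le {α : Type*} (s : Finset α) (f : α → Set X) :
    covNum δ (⋃ i ∈ s, f i) ≤ ∑ i ∈ s, covNum δ (f i) := by
  classical
  induction s using Finset.induction_on with
  | empty => simp [covNum_empty]
  | insert i s hi ih =>
    rw [Finset.set_biUnion_insert, Finset.sum_insert hi]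
    exact (covNum_union_le _ _).trans (add_le_add_right ih _)

lemma covNum_pos {A : Set X} (hA : A.Nonempty) : 0 < covNum δ A := by
  unfold covNum
  have := Metric.externalCoveringNumber_pos_iff (ε := δ.toNNReal) |>.2 hA
  exact_mod_cast this

lemma covNum_lt_top [ProperSpace X] (hδ : 0 < δ) {A : Set X} (hA : Bornology.IsBounded A) :
    covNum δ A < ⊤ := by
  obtain ⟨N, -, hfin, hN⟩ := Metric.exists_finite_isCover_of_isCompact_closure
    (ε := δ.toNNReal) (by simpa using hδ) hA.isCompact_closure
  have h1 := hN.externalCoveringNumber_le_encard.trans_lt hfin.encard_lt_top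
  have h2 : Metric.externalCoveringNumber δ.toNNReal A ≠ ⊤ := h1.ne
  unfold covNum
  exact lt_top_iff_ne_top.2 (by simpa using h2)

lemma covNum_le_one {A : Set X} {x : X} (hδ : 0 ≤ δ) (h : A ⊆ Metric.closedBall x δ) :
    covNum δ A ≤ 1 := by
  have : Metric.IsCover δ.toNNReal A {x} := by
    rw [Metric.isCover_iff_subset_iUnion_closedBall]
    simpa [Real.coe_toNNReal δ hδ] using h
  have h2 := this.externalCoveringNumber_le_encard
  rw [Set.encard_singleton] at h2
  unfold covNum
  exact_mod_cast h2

end CoveringNumbers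

section Squares

lemma dist_le_add (x y : Plane) : dist x y ≤ |x 0 - y 0| + |x 1 - y 1| := by
  rw [EuclideanSpace.dist_eq, Fin.sum_univ_two]
  refine Real.sqrt_le_iff.2 ⟨by positivity, ?_⟩
  rw [Real.dist_eq, Real.dist_eq]
  nlinarith [abs_nonneg (x 0 - y 0), abs_nonneg (x 1 - y 1)]

lemma abs_sub_le_dist (x y : Plane) (i : Fin 2) : |x i - y i| ≤ dist x y := by
  rw [dist_eq_norm]
  exact PiLp.norm_apply_le (x - y) i

lemma mem_gridSquare_iff {δ : ℝ} (hδ : 0 < δ) {k : Fin 2 → ℤ} {x : Plane} :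
    x ∈ gridSquare δ k ↔ ∀ i, ⌊x i / δ⌋ = k i := by
  simp only [gridSquare, Set.mem_ofPred_eq, Set.mem_Ico, Int.floor_eq_iff, le_div_iff₀ hδ,
    div_lt_iff₀ hδ]

lemma gridSquare_eq_of_mem {δ : ℝ} (hδ : 0 < δ) {k k' : Fin 2 → ℤ} {x : Plane}
    (h : x ∈ gridSquare δ k) (h' : x ∈ gridSquare δ k') : k = k' := by
  rw [mem_gridSquare_iff hδ] at h h'
  ext i
  rw [← h, ← h']

/-- The lower left corner of a dyadic square. -/
noncomputable def corner (δ : ℝ) (k : Fin 2 → ℤ) : Plane := WithLp.toLp 2 fun i => (k i : ℝ) * δ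

@[simp] lemma corner_apply (δ : ℝ) (k : Fin 2 → ℤ) (i : Fin 2) : corner δ k i = k i * δ := rfl

lemma corner_mem_gridSquare {δ : ℝ} (hδ : 0 < δ) (k : Fin 2 → ℤ) : corner δ k ∈ gridSquare δ k :=
  fun i => ⟨le_rfl, by rw [corner_apply]; gcongr; linarith⟩

lemma abs_sub_corner_le {δ : ℝ} {k : Fin 2 → ℤ} {x : Plane} (h : x ∈ gridSquare δ k) (i : Fin 2) :
    |x i - k i * δ| ≤ δ := by
  have := h i
  rw [Set.mem_Ico] at this
  rw [abs_le]
  constructor <;> linarith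

lemma abs_sub_le_of_mem_gridSquare {δ : ℝ} {k : Fin 2 → ℤ} {x y : Plane} (h : x ∈ gridSquare δ k)
    (h' : y ∈ gridSquare δ k) (i : Fin 2) : |x i - y i| ≤ δ := by
  have h1 := h i
  have h2 := h' i
  rw [Set.mem_Ico] at h1 h2
  rw [abs_le]
  constructor <;> linarith

lemma gridSquare_subset_closedBall {δ : ℝ} (k : Fin 2 → ℤ) :
    gridSquare δ k ⊆ Metric.closedBall (corner δ k) (2 * δ) := fun x hx => by
  rw [Metric.mem_closedBall]
  have h0 := abs_sub_corner_le hx 0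
  have h1 := abs_sub_corner_le hx 1
  refine (dist_le_add _ _).trans ?_
  simp only [corner_apply]
  linarith

lemma covNum_gridSquare_le_one {δ : ℝ} (hδ : 0 < δ) (k : Fin 2 → ℤ) :
    covNum δ (gridSquare δ k) ≤ 1 := by
  refine covNum_le_one (x := WithLp.toLp 2 fun i => ((k i : ℝ) + 1 / 2) * δ) hδ.le fun x hx => ?_
  rw [Metric.mem_closedBall]
  have hi : ∀ i, |x i - ((k i : ℝ) + 1 / 2) * δ| ≤ δ / 2 := fun i => by
    have := hx i
    rw [Set.mem_Ico] at this
    rw [abs_le]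
    constructor <;> linarith
  refine (dist_le_add _ _).trans ?_
  have h0 := hi 0
  have h1 := hi 1
  simp only
  linarith

lemma measurableSet_gridSquare (δ : ℝ) (k : Fin 2 → ℤ) : MeasurableSet (gridSquare δ k) := by
  have : gridSquare δ k = ⋂ i, (fun x : Plane => x i) ⁻¹'
      Set.Ico ((k i : ℝ) * δ) (((k i : ℝ) + 1) * δ) := by
    ext x; simp [gridSquare]
  rw [this]
  refine MeasurableSet.iInter fun i => measurableSet_Ico.preimage ?_
  exact (EuclideanSpace.proj (𝕜 := ℝ) i).continuous.measurable

lemma gridSquare_subset_ancestor {δ : ℝ} (hδ : 0 < δ) (i : ℕ) (k : Fin 2 → ℤ) :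
    gridSquare δ k ⊆ gridSquare (2 ^ i * δ) (ancestor i k) := fun x hx a => by
  have h := hx a
  rw [Set.mem_Ico] at h
  have l1 := ancestor_apply_le i k a
  have l2 : (k a : ℝ) + 1 ≤ 2 ^ i * (ancestor i k a : ℝ) + 2 ^ i := by
    have := lt_ancestor_apply i k a
    have h2 : k a < 2 ^ i * ancestor i k a + 2 ^ i := by exact_mod_cast this
    have h3 : k a + 1 ≤ 2 ^ i * ancestor i k a + 2 ^ i := h2
    exact_mod_cast h3
  constructor
  · nlinarith [h.1, mul_le_mul_of_nonneg_right l1 hδ.le]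
  · nlinarith [h.2, mul_le_mul_of_nonneg_right l2 hδ.le]

lemma proj_eq_angleForm (θ : ℝ) (z : Plane) : proj θ z = angleForm θ (z 0) (z 1) := rfl

lemma abs_angleForm_le (x a b : ℝ) : |angleForm x a b| ≤ |a| + |b| := by
  unfold angleForm
  refine (abs_add_le _ _).trans ?_
  rw [abs_mul, abs_mul]
  gcongr
  · exact mul_le_of_le_one_right (abs_nonneg _) (Real.abs_cos_le_one _)
  · exact mul_le_of_le_one_right (abs_nonneg _) (Real.abs_sin_le_one _)

lemma abs_angleForm_sub_le (x y a b : ℝ) :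
    |angleForm x a b - angleForm y a b| ≤ 2 * Real.pi * |x - y| * (|a| + |b|) := by
  have hc := Real.abs_cos_sub_cos_le (2 * Real.pi * x) (2 * Real.pi * y)
  have hs := Real.abs_sin_sub_sin_le (2 * Real.pi * x) (2 * Real.pi * y)
  have e : |2 * Real.pi * x - 2 * Real.pi * y| = 2 * Real.pi * |x - y| := by
    rw [← mul_sub, abs_mul, abs_of_pos Real.two_pi_pos]
  rw [e] at hc hs
  have e2 : angleForm x a b - angleForm y a b =
      a * (Real.cos (2 * Real.pi * x) - Real.cos (2 * Real.pi * y)) +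
      b * (Real.sin (2 * Real.pi * x) - Real.sin (2 * Real.pi * y)) := by
    unfold angleForm; ring
  rw [e2]
  refine (abs_add_le _ _).trans ?_
  rw [abs_mul, abs_mul]
  calc _ ≤ |a| * (2 * Real.pi * |x - y|) + |b| * (2 * Real.pi * |x - y|) := by gcongr
    _ = _ := by ring

end Squares

end Furstenberg

/-! ### Tube cells: pigeonholing of generations -/

namespace Furstenberg

section TubeCells

/-- The indices of the parameter squares of the tubes in `𝒯`. -/
def tubeCells (δ : ℝ) (𝒯 : Set (Set Plane)) : Set (Fin 2 → ℤ) :=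
  {k | gridSquare δ k ∈ paramSquares δ ∧ tube (gridSquare δ k) ∈ 𝒯}

lemma paramUnion_eq (δ : ℝ) (𝒯 : Set (Set Plane)) :
    paramUnion δ 𝒯 = ⋃ k ∈ tubeCells δ 𝒯, gridSquare δ k := by
  ext x
  simp only [paramUnion, Set.mem_sUnion, Set.mem_iUnion, tubeCells]
  constructor
  · rintro ⟨Q, ⟨hQ, hT⟩, hx⟩
    obtain ⟨k, rfl⟩ := hQ.1
    exact ⟨k, ⟨hQ, hT⟩, hx⟩
  · rintro ⟨k, hk, hx⟩
    exact ⟨_, hk, hx⟩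

lemma abs_angleForm_le_one {x a b : ℝ} (h : a ^ 2 + b ^ 2 ≤ 1) : |angleForm x a b| ≤ 1 := by
  unfold angleForm
  rw [← sq_le_one_iff_abs_le_one]
  have := Real.sin_sq_add_cos_sq (2 * Real.pi * x)
  generalize Real.sin (2 * Real.pi * x) = v at *
  generalize Real.cos (2 * Real.pi * x) = w at *
  nlinarith [sq_nonneg (a * v - b * w)]

lemma coord_sq_le_one {x : Plane} (hx : x ∈ Metric.closedBall (0 : Plane) 1) :
    x 0 ^ 2 + x 1 ^ 2 ≤ 1 := by
  rw [mem_closedBall_zero_iff, EuclideanSpace.norm_eq, Fin.sum_univ_two, Real.sqrt_le_iff] at hx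
  simpa using hx.2

/-- A line through a point within one `δ`-square of the unit disc has `|r| ≤ 1 + 2δ`, and passing to
the corner of the cell costs another `δ`; since `δ ≤ 1` the total is at most `4`. -/
lemma cell_bounds {n : ℕ} {δ : ℝ} (hδ : δ = (1 / 2) ^ n) {k p : Fin 2 → ℤ} {x : Plane}
    (hk : gridSquare δ k ∈ paramSquares δ) (hx : x ∈ gridSquare δ p)
    (hx1 : x ∈ Metric.closedBall (0 : Plane) 1)
    (hT : (tube (gridSquare δ k) ∩ gridSquare δ p).Nonempty) :
    (0 ≤ k 0 ∧ k 0 < 2 ^ n) ∧ |k 1| ≤ 4 * 2 ^ n := by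
  have hδ0 : 0 < δ := by rw [hδ]; positivity
  have hδ1 : δ ≤ 1 := by rw [hδ]; exact pow_le_one₀ (by norm_num) (by norm_num)
  have hδn : δ * 2 ^ n = 1 := by rw [hδ, ← mul_pow]; norm_num
  have hc := hk.2 _ (corner_mem_gridSquare hδ0 k)
  rw [corner_apply, Set.mem_Ico] at hc
  refine ⟨⟨?_, ?_⟩, ?_⟩
  · have : (0 : ℝ) ≤ k 0 := nonneg_of_mul_nonneg_left hc.1 hδ0
    exact_mod_cast this
  · have : (k 0 : ℝ) < 2 ^ n := by
      refine lt_of_mul_lt_mul_right (a := δ) ?_ hδ0.le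
      rw [mul_comm (2 ^ n), hδn]; exact hc.2
    exact_mod_cast this
  · obtain ⟨z, hz, hzp⟩ := hT
    simp only [tube, Set.mem_iUnion] at hz
    obtain ⟨q, hq, hqz⟩ := hz
    change proj (q 0) z = q 1 at hqz
    rw [proj_eq_angleForm] at hqz
    have h1 := abs_angleForm_le_one (x := q 0) (coord_sq_le_one hx1)
    have h2 := abs_angleForm_le (q 0) (z 0 - x 0) (z 1 - x 1)
    rw [← angleForm_sub_angleForm, hqz] at h2
    have h3 := abs_sub_le_of_mem_gridSquare hzp hx 0
    have h4 := abs_sub_le_of_mem_gridSquare hzp hx 1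
    have h5 := abs_sub_corner_le hq 1
    have h6 : |(k 1 : ℝ) * δ| ≤ 4 := by
      replace h2 := h2.trans (add_le_add h3 h4)
      rw [abs_le] at *
      constructor <;> linarith
    rw [abs_mul, abs_of_pos hδ0] at h6
    have h7 : |(k 1 : ℝ)| ≤ 4 * 2 ^ n := by
      refine le_of_mul_le_mul_right (a := δ) ?_ hδ0
      rw [mul_assoc, mul_comm (2 ^ n), hδn]; linarith
    exact_mod_cast h7

lemma isBounded_paramUnion {δ : ℝ} {𝒯 : Set (Set Plane)} (h : (tubeCells δ 𝒯).Finite) :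
    Bornology.IsBounded (paramUnion δ 𝒯) := by
  rw [paramUnion_eq, Bornology.isBounded_biUnion h]
  exact fun k _ => Metric.isBounded_closedBall.subset (gridSquare_subset_closedBall k)

open Classical in
/-- If a `(δ, s, C)`-set of tubes is covered by squares of different generations, then some
generation contributes many squares. -/
lemma exists_generation_card_ge {δ s C : ℝ} (hδ : 0 < δ) (hC : 0 ≤ C) {n : ℕ}
    {𝒯 : Set (Set Plane)}
    (hfin : (tubeCells δ 𝒯).Finite) (hne : (tubeCells δ 𝒯).Nonempty) (hset : IsDeltaTubeSet δ s C 𝒯)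
    {Q : ℕ → Finset (Fin 2 → ℤ)}
    (hQ : ∀ k ∈ tubeCells δ 𝒯, ∃ i ∈ Finset.range (n + 1), ancestor i k ∈ Q i) {α : ℕ → ℝ}
    (hα : ∑ i ∈ Finset.range (n + 1), α i ≤ 1) :
    ∃ i ∈ Finset.range (n + 1), α i ≤
      (((Q i).filter fun l => (gridSquare (2 ^ i * δ) l ∩ paramUnion δ 𝒯).Nonempty).card : ℝ) *
        (C * (2 * (2 ^ i * δ)) ^ s) := by
  set P := paramUnion δ 𝒯 with hP
  set Q' : ℕ → Finset (Fin 2 → ℤ) := fun i =>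
    (Q i).filter fun l => (gridSquare (2 ^ i * δ) l ∩ P).Nonempty with hQ'
  set N := covNum δ P with hN
  have hNtop : N ≠ ⊤ := (covNum_lt_top hδ (isBounded_paramUnion hfin)).ne
  have hPne : P.Nonempty := by
    obtain ⟨k, hk⟩ := hne
    exact ⟨corner δ k, by
      rw [hP, paramUnion_eq]; exact Set.mem_biUnion hk (corner_mem_gridSquare hδ k)⟩
  have hN0 : N ≠ 0 := (covNum_pos hPne).ne'
  have hcov : P ⊆ ⋃ i ∈ Finset.range (n + 1), ⋃ l ∈ Q' i,
      P ∩ Metric.closedBall (corner (2 ^ i * δ) l) (2 * (2 ^ i * δ)) := by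
    intro x hx
    have hx' := hx
    rw [hP, paramUnion_eq, Set.mem_iUnion₂] at hx'
    obtain ⟨k, hk, hxk⟩ := hx'
    obtain ⟨i, hi, hki⟩ := hQ k hk
    have hxi := gridSquare_subset_ancestor hδ i k hxk
    refine Set.mem_biUnion hi (Set.mem_biUnion (x := ancestor i k) ?_
      ⟨hx, gridSquare_subset_closedBall _ hxi⟩)
    simp only [hQ', Finset.coe_filter]
    exact ⟨hki, x, hxi, hx⟩
  -- Each cell lies in a ball of radius twice its side, to which the `(δ,s,C)` condition applies.
  -- The covering number `N` then appears on both sides and cancels, being positive and finite.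
  have h1 : N ≤ (∑ i ∈ Finset.range (n + 1),
      ENNReal.ofReal (((Q' i).card : ℝ) * (C * (2 * (2 ^ i * δ)) ^ s))) * N := by
    refine (covNum_mono hcov).trans ((covNum_biUnion_le _ _).trans ?_)
    rw [Finset.sum_mul]
    refine Finset.sum_le_sum fun i _ => (covNum_biUnion_le _ _).trans ?_
    have hle : δ ≤ 2 * (2 ^ i * δ) := by
      have : (1 : ℝ) ≤ 2 ^ i := one_le_pow₀ one_le_two
      nlinarith
    refine (Finset.sum_le_sum fun l _ => hset (corner (2 ^ i * δ) l) _ hle).trans (le_of_eq ?_)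
    rw [Finset.sum_const, nsmul_eq_mul, ENNReal.ofReal_mul (Nat.cast_nonneg _),
      ENNReal.ofReal_natCast, mul_assoc]
  have h2 : 1 ≤ ∑ i ∈ Finset.range (n + 1), ((Q' i).card : ℝ) * (C * (2 * (2 ^ i * δ)) ^ s) := by
    rw [← ENNReal.ofReal_sum_of_nonneg (fun i _ => by positivity)] at h1
    by_contra hlt
    push Not at hlt
    have h3 : ENNReal.ofReal
        (∑ i ∈ Finset.range (n + 1), ((Q' i).card : ℝ) * (C * (2 * (2 ^ i * δ)) ^ s)) < 1 :=
      ENNReal.ofReal_lt_one.2 hlt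
    have h4 := ENNReal.mul_lt_mul_left hN0 hNtop h3
    rw [one_mul] at h4
    exact absurd h1 (not_le.2 h4)
  exact Finset.exists_le_of_sum_le ⟨0, by simp⟩ (hα.trans h2)

end TubeCells

/-! ### Lower bounds for incidences and the final numerical comparison -/

section LowerBound

/-- The kernel of width `2ρ` at distance at most `42ρ` is at least `2 / (1768 ρ)`. -/
lemma inv_le_average_cauchyKernel {ρ θ r a b : ℝ} (hρ : 0 < ρ)
    (h : ∀ x ∈ Set.Icc (θ - ρ) θ, |angleForm x a b - r| ≤ 42 * ρ) :
    (1000 * ρ)⁻¹ ≤ ρ⁻¹ * ∫ x in (θ - ρ)..θ, cauchyKernel (2 * ρ) (angleForm (x - 0) a b - r) := by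
  have h1 : ∫ _x in (θ - ρ)..θ, (1000 * ρ)⁻¹ ≤
      ∫ x in (θ - ρ)..θ, cauchyKernel (2 * ρ) (angleForm (x - 0) a b - r) := by
    refine intervalIntegral.integral_mono_on (by linarith) (by simp) ?_ fun x hx => ?_
    · exact ((continuous_cauchyKernel (by positivity)).comp (((continuous_angleForm _ _).comp
        (by fun_prop)).sub continuous_const)).intervalIntegrable _ _
    · have h2 := h x hx
      rw [sub_zero, cauchyKernel]
      have h3 : |angleForm x a b - r| ^ 2 ≤ (42 * ρ) ^ 2 := by gcongr
      rw [sq_abs] at h3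
      rw [inv_eq_one_div, div_le_div_iff₀ (by positivity) (by positivity)]
      nlinarith
  rw [intervalIntegral.integral_const, smul_eq_mul] at h1
  rw [le_inv_mul_iff₀ hρ]
  refine le_trans (le_of_eq ?_) h1
  ring

/-- Every angle in the window is within `3ρ` of that of a line meeting the small square, costing `2π
* 3ρ * 2 ≤ 38ρ`. Moving within the `δ`-square costs `2ρ`, and replacing `r` by the corner value of
the coarse cell another `2ρ`. -/
lemma abs_angleForm_sub_le_of_incident {ρ δ : ℝ} (hδρ : δ ≤ ρ)
    {k p l : Fin 2 → ℤ} {q x : Plane} (hT : (tube (gridSquare δ k) ∩ gridSquare δ p).Nonempty)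
    (hq : q ∈ gridSquare δ k) (hql : q ∈ gridSquare ρ l) (hx : x ∈ gridSquare δ p)
    (hx1 : x ∈ Metric.closedBall (0 : Plane) 1) {y : ℝ}
    (hy : y ∈ Set.Icc (l 0 * ρ - ρ) (l 0 * ρ)) :
    |angleForm y (x 0) (x 1) - l 1 * ρ| ≤ 42 * ρ := by
  obtain ⟨z, hz, hzp⟩ := hT
  simp only [tube, Set.mem_iUnion] at hz
  obtain ⟨q', hq', hqz⟩ := hz
  change proj (q' 0) z = q' 1 at hqz
  rw [proj_eq_angleForm] at hqz
  have a0 := abs_sub_le_of_mem_gridSquare hq hq' 0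
  have a1 := abs_sub_le_of_mem_gridSquare hq hq' 1
  have b0 := abs_sub_corner_le hql 0
  have b1 := abs_sub_corner_le hql 1
  have c0 := abs_sub_le_of_mem_gridSquare hx hzp 0
  have c1 := abs_sub_le_of_mem_gridSquare hx hzp 1
  have hx2 := coord_sq_le_one hx1
  have d0 : |x 0| ≤ 1 := by rw [← sq_le_one_iff_abs_le_one]; nlinarith [sq_nonneg (x 1)]
  have d1 : |x 1| ≤ 1 := by rw [← sq_le_one_iff_abs_le_one]; nlinarith [sq_nonneg (x 0)]
  have hρ : 0 ≤ ρ := (abs_nonneg _).trans b0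
  have e0 : |y - q' 0| ≤ 3 * ρ := by
    rw [abs_le] at *
    constructor <;> linarith [hy.1, hy.2]
  have e1 : |angleForm y (x 0) (x 1) - angleForm (q' 0) (x 0) (x 1)| ≤ 38 * ρ := by
    refine (abs_angleForm_sub_le _ _ _ _).trans ?_
    have hpi := Real.pi_lt_d2
    have hpi0 := Real.pi_pos
    calc 2 * Real.pi * |y - q' 0| * (|x 0| + |x 1|) ≤ 2 * 3.15 * (3 * ρ) * (1 + 1) := by gcongr
      _ ≤ 38 * ρ := by nlinarith
  have e2 := abs_angleForm_le (q' 0) (x 0 - z 0) (x 1 - z 1)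
  rw [← angleForm_sub_angleForm, hqz] at e2
  replace e2 := e2.trans (add_le_add c0 c1)
  rw [abs_le] at *
  constructor <;> linarith

/-- If `W ≥ 1` the claim is trivial because `M ≤ C`. Otherwise `M W ≤ √(C M W)`, so the square-root
term controls the whole right-hand side, and squaring gives the bound. The number `34` comes from
`16 * 72 ≤ 34 ^ 2`. -/
lemma le_of_le_add_sqrt {c A M W C : ℝ} (hc : 0 < c) (hc1 : c ≤ 1) (hA : 0 ≤ A) (hM : 0 < M)
    (hW : 0 ≤ W) (hC : 1 ≤ C) (hMC : M ≤ C)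
    (h : c * M / C ≤ M * W + A * Real.sqrt (16 * C * 72 * M * W)) :
    (c / (1 + 34 * A)) ^ 2 * M / C ^ 3 ≤ W := by
  have hC0 : 0 < C := by linarith
  have hA1 : 1 ≤ 1 + 34 * A := by linarith
  rcases le_total 1 W with hW1 | hW1
  · refine le_trans ?_ hW1
    have h1 : c / (1 + 34 * A) ≤ 1 := div_le_one_of_le₀ (by linarith) (by linarith)
    have h2 : (c / (1 + 34 * A)) ^ 2 ≤ 1 := pow_le_one₀ (by positivity) h1
    rw [div_le_one (by positivity)]
    calc (c / (1 + 34 * A)) ^ 2 * M ≤ 1 * C := by gcongr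
      _ ≤ C ^ 3 := by nlinarith [sq_nonneg C]
  · set D := Real.sqrt (C * M * W) with hD
    have hD0 : 0 ≤ D := Real.sqrt_nonneg _
    have hD2 : D ^ 2 = C * M * W := Real.sq_sqrt (by positivity)
    have h1 : M * W ≤ D := by
      refine Real.le_sqrt_of_sq_le ?_
      calc (M * W) ^ 2 = M * M * W * W := by ring
        _ ≤ C * M * W * 1 := by gcongr
        _ = C * M * W := by ring
    have h2 : Real.sqrt (16 * C * 72 * M * W) ≤ 34 * D := by
      refine Real.sqrt_le_iff.2 ⟨by positivity, ?_⟩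
      rw [mul_pow, hD2]
      have : 0 ≤ C * M * W := by positivity
      nlinarith
    have h3 : c * M / C ≤ (1 + 34 * A) * D := by
      have := mul_le_mul_of_nonneg_left h2 hA
      linarith
    have h4 : (c * M / C) ^ 2 ≤ (1 + 34 * A) ^ 2 * (C * M * W) := by
      rw [← hD2, ← mul_pow]
      exact pow_le_pow_left₀ (by positivity) h3 2
    have h5 : c ^ 2 * M ≤ (1 + 34 * A) ^ 2 * C ^ 3 * W := by
      refine le_of_mul_le_mul_left ?_ (by positivity : 0 < M / C ^ 2)
      calc M / C ^ 2 * (c ^ 2 * M) = (c * M / C) ^ 2 := by field_simp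
        _ ≤ (1 + 34 * A) ^ 2 * (C * M * W) := h4
        _ = M / C ^ 2 * ((1 + 34 * A) ^ 2 * C ^ 3 * W) := by field_simp
    rw [div_pow, div_mul_eq_mul_div, div_div, div_le_iff₀ (by positivity)]
    linarith

/-- These are the pigeonhole weights for the generations: with `x = 2 ^ (-ε)`, generation `i` has
weight `(1 - x) ρ ^ ε` for `ρ = 2 ^ (i - n)`. A small power of the scale is lost instead of a factor
`n`. -/
lemma sum_geometric_weights_le {x : ℝ} (hx0 : 0 ≤ x) (n : ℕ) :
    ∑ i ∈ Finset.range (n + 1), (1 - x) * x ^ (n - i) ≤ 1 := by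
  rw [← Finset.mul_sum]
  have h1 : ∑ i ∈ Finset.range (n + 1), x ^ (n - i) = ∑ i ∈ Finset.range (n + 1), x ^ i := by
    rw [← Finset.sum_range_reflect]
    refine Finset.sum_congr rfl fun i hi => ?_
    congr 1
    have := Finset.mem_range.1 hi
    omega
  rw [h1, mul_neg_geom_sum]
  have := pow_nonneg hx0 (n + 1)
  linarith

end LowerBound

end Furstenberg

/-! ### The measure discretised at scale `δ` -/

namespace Furstenberg

section FrostmanMeasure

open MeasureTheory

variable {μ : Measure Plane}

lemma support_subset_closedBall (hμ : μ (Metric.closedBall 0 1)ᶜ = 0) :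
    μ.support ⊆ Metric.closedBall 0 1 :=
  Measure.support_subset_of_isClosed Metric.isClosed_closedBall (mem_ae_iff.2 hμ)

lemma measure_univ_le {C t : ℝ} (hμ : μ (Metric.closedBall 0 1)ᶜ = 0)
    (hball : ∀ (x : Plane) (r : ℝ), 0 < r → μ (Metric.closedBall x r) ≤ ENNReal.ofReal (C * r ^ t)) :
    μ Set.univ ≤ ENNReal.ofReal C := by
  have h1 := hball 0 1 one_pos
  rw [Real.one_rpow, mul_one] at h1
  calc μ Set.univ ≤ μ (Metric.closedBall 0 1) + μ (Metric.closedBall 0 1)ᶜ := by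
        rw [← Set.union_compl_self (Metric.closedBall (0 : Plane) 1)]
        exact measure_union_le _ _
    _ ≤ _ := by rw [hμ, add_zero]; exact h1

lemma finite_cells_meeting {n : ℕ} {δ : ℝ} (hδ : δ = (1 / 2) ^ n) {A : Set Plane}
    (hA : A ⊆ Metric.closedBall 0 1) : {k | (gridSquare δ k ∩ A).Nonempty}.Finite := by
  have hδ0 : 0 < δ := by rw [hδ]; positivity
  have hδn : δ * 2 ^ n = 1 := by rw [hδ, ← mul_pow]; norm_num
  refine (Set.finite_Icc (fun _ : Fin 2 => -(2 : ℤ) ^ n) fun _ => (2 : ℤ) ^ n).subset ?_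
  rintro k ⟨x, hx, hxA⟩
  have hn : ‖x‖ ≤ 1 := mem_closedBall_zero_iff.1 (hA hxA)
  have key : ∀ a, -(2 : ℤ) ^ n ≤ k a ∧ k a ≤ (2 : ℤ) ^ n := fun a => by
    have h1 := abs_le.1 ((PiLp.norm_apply_le x a).trans hn)
    rw [← (mem_gridSquare_iff hδ0).1 hx a]
    constructor
    · rw [Int.le_floor, le_div_iff₀ hδ0]
      push_cast
      linarith [h1.1]
    · rw [← Int.floor_intCast (R := ℝ) ((2 : ℤ) ^ n)]
      refine Int.floor_le_floor ?_
      rw [div_le_iff₀ hδ0]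
      push_cast
      linarith [h1.2]
  exact Set.mem_Icc.2 ⟨fun a => (key a).1, fun a => (key a).2⟩

lemma sum_measureReal_gridSquare [IsFiniteMeasure μ] {δ : ℝ} (hδ : 0 < δ)
    {X : Finset (Fin 2 → ℤ)} (hX : ∀ k, k ∈ X ↔ (gridSquare δ k ∩ μ.support).Nonempty) :
    ∑ k ∈ X, μ.real (gridSquare δ k) = μ.real Set.univ := by
  rw [← measureReal_biUnion_finset (fun k _ k' _ hkk' => Set.disjoint_left.2 fun x hx hx' =>
    hkk' (gridSquare_eq_of_mem hδ hx hx')) fun k _ => measurableSet_gridSquare δ k]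
  have h1 : μ.support ⊆ ⋃ k ∈ X, gridSquare δ k := fun x hx => by
    have hk : x ∈ gridSquare δ fun a => ⌊x a / δ⌋ := (mem_gridSquare_iff hδ).2 fun _ => rfl
    exact Set.mem_biUnion (x := fun a => ⌊x a / δ⌋) ((hX _).2 ⟨x, hk, hx⟩) hk
  have h2 : μ (⋃ k ∈ X, gridSquare δ k) = μ Set.univ := by
    refine le_antisymm (measure_mono (Set.subset_univ _)) ?_
    calc μ Set.univ ≤ μ (⋃ k ∈ X, gridSquare δ k) + μ (⋃ k ∈ X, gridSquare δ k)ᶜ := by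
          rw [← Set.union_compl_self (⋃ k ∈ X, gridSquare δ k)]
          exact measure_union_le _ _
      _ ≤ μ (⋃ k ∈ X, gridSquare δ k) + μ μ.supportᶜ := by
          gcongr
      _ = _ := by rw [Measure.measure_compl_support, add_zero]
  rw [Measure.real, h2, Measure.real]

/-- The squares concerned lie in a ball of radius `4l`, and `4 ^ t ≤ 16`. -/
lemma sum_measureReal_near_le [IsFiniteMeasure μ] {δ C t l : ℝ} (hδ : 0 < δ) (hδl : δ ≤ l)
    (hC : 0 ≤ C) (ht : t ≤ 2)
    (hball : ∀ (x : Plane) (r : ℝ), 0 < r → μ (Metric.closedBall x r) ≤ ENNReal.ofReal (C * r ^ t))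
    {X : Finset (Fin 2 → ℤ)} {f : (Fin 2 → ℤ) → Plane} (hf : ∀ k ∈ X, f k ∈ gridSquare δ k)
    (x : Plane) :
    ∑ k ∈ X with max |x 0 - f k 0| |x 1 - f k 1| ≤ l, μ.real (gridSquare δ k) ≤
      16 * C * l ^ t := by
  have hl : 0 < l := hδ.trans_le hδl
  rw [← measureReal_biUnion_finset (fun k _ k' _ hkk' => Set.disjoint_left.2 fun x hx hx' =>
    hkk' (gridSquare_eq_of_mem hδ hx hx')) fun k _ => measurableSet_gridSquare δ k]
  have h1 : (⋃ k ∈ X.filter fun k => max |x 0 - f k 0| |x 1 - f k 1| ≤ l, gridSquare δ k) ⊆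
      Metric.closedBall x (4 * l) := by
    intro y hy
    rw [Set.mem_iUnion₂] at hy
    obtain ⟨k, hk, hyk⟩ := hy
    rw [Finset.mem_filter, max_le_iff] at hk
    have h0 := abs_sub_le_of_mem_gridSquare hyk (hf k hk.1) 0
    have h1 := abs_sub_le_of_mem_gridSquare hyk (hf k hk.1) 1
    rw [Metric.mem_closedBall]
    refine (dist_le_add _ _).trans ?_
    have e0 : |y 0 - x 0| ≤ 2 * l := by
      have := hk.2.1
      rw [abs_le] at *
      constructor <;> linarith
    have e1 : |y 1 - x 1| ≤ 2 * l := by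
      have := hk.2.2
      rw [abs_le] at *
      constructor <;> linarith
    linarith
  have h2 : μ.real (Metric.closedBall x (4 * l)) ≤ C * (4 * l) ^ t :=
    ENNReal.toReal_le_of_le_ofReal (by positivity) (hball x (4 * l) (by positivity))
  refine (measureReal_mono h1).trans (h2.trans ?_)
  rw [Real.mul_rpow (by norm_num) hl.le]
  have h3 : (4 : ℝ) ^ t ≤ 16 := by
    calc (4 : ℝ) ^ t ≤ 4 ^ (2 : ℝ) := Real.rpow_le_rpow_of_exponent_le (by norm_num) ht
      _ = 16 := by norm_num
  have h4 : 0 ≤ C * l ^ t := by positivity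
  nlinarith

end FrostmanMeasure

/-! ### One generation with many saturated cells -/

section Generation

open MeasureTheory

open Classical in
/-- Lower bound for the smoothed incidences, given that the weight-carrying points `f k`,
`k ∈ X'`, have many incident lines. -/
lemma le_smoothedIncidence {δ ρ u N : ℝ} (hρ : 0 < ρ) (hδρ : δ ≤ ρ)
    {X X' Y : Finset (Fin 2 → ℤ)} (hX' : X' ⊆ X) {m : (Fin 2 → ℤ) → ℝ} (hm : ∀ k ∈ X, 0 ≤ m k)
    {f : (Fin 2 → ℤ) → Plane} (hf : ∀ k ∈ X, f k ∈ gridSquare δ k)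
    (hf1 : ∀ k ∈ X, f k ∈ Metric.closedBall (0 : Plane) 1) {𝒯 : Set Plane → Set (Set Plane)}
    (hT : ∀ k ∈ X, ∀ T ∈ 𝒯 (gridSquare δ k), (T ∩ gridSquare δ k).Nonempty)
    (hN : ∀ k ∈ X', N ≤ ((Y.filter fun l =>
      (gridSquare ρ l ∩ paramUnion δ (𝒯 (gridSquare δ k))).Nonempty).card : ℝ)) :
    (∑ k ∈ X', m k) * (N * (ρ ^ u * (1000 * ρ)⁻¹)) ≤
      smoothedIncidence X Y (fun k => f k 0) (fun k => f k 1) m (fun l => l 0 * ρ)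
        (fun l => l 1 * ρ) (fun _ => ρ ^ u) ρ (2 * ρ) 0 := by
  have hav : ∀ k ∈ X, ∀ l : Fin 2 → ℤ, 0 ≤ ρ⁻¹ * ∫ x in ((l 0 : ℝ) * ρ - ρ)..(l 0 * ρ),
      cauchyKernel (2 * ρ) (angleForm (x - 0) (f k 0) (f k 1) - l 1 * ρ) := fun k _ l =>
    mul_nonneg (by positivity) (intervalIntegral.integral_nonneg (by linarith)
      fun x _ => cauchyKernel_nonneg (by positivity) _)
  unfold smoothedIncidence
  rw [Finset.sum_comm, Finset.sum_mul]
  refine le_trans ?_ (Finset.sum_le_sum_of_subset_of_nonneg hX' fun k hk _ =>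
    Finset.sum_nonneg fun l _ => mul_nonneg (mul_nonneg (by positivity) (hm k hk)) (hav k hk l))
  refine Finset.sum_le_sum fun k hk => ?_
  have hkX := hX' hk
  refine le_trans ?_ (Finset.sum_le_sum_of_subset_of_nonneg (Finset.filter_subset (fun l =>
    (gridSquare ρ l ∩ paramUnion δ (𝒯 (gridSquare δ k))).Nonempty) Y) fun l _ _ =>
    mul_nonneg (mul_nonneg (by positivity) (hm k hkX)) (hav k hkX l))
  have hcount := mul_le_mul_of_nonneg_right (hN k hk)
    (mul_nonneg (hm k hkX) (by positivity : 0 ≤ ρ ^ u * (1000 * ρ)⁻¹))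
  refine le_trans (le_of_eq (by ring)) (hcount.trans ?_)
  rw [← nsmul_eq_mul, ← Finset.sum_const]
  refine Finset.sum_le_sum fun l hl => ?_
  obtain ⟨q, hql, hqP⟩ := (Finset.mem_filter.1 hl).2
  rw [paramUnion_eq, Set.mem_iUnion₂] at hqP
  obtain ⟨k', hk', hqk'⟩ := hqP
  have h1 := inv_le_average_cauchyKernel (ρ := ρ) (θ := l 0 * ρ) (r := l 1 * ρ) (a := f k 0)
    (b := f k 1) hρ fun x hx =>
      abs_angleForm_sub_le_of_incident hδρ (hT k hkX _ hk'.2) hqk' hql (hf k hkX) (hf1 k hkX) hx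
  calc m k * (ρ ^ u * (1000 * ρ)⁻¹) = ρ ^ u * m k * (1000 * ρ)⁻¹ := by ring
    _ ≤ _ := mul_le_mul_of_nonneg_left h1 (mul_nonneg (by positivity) (hm k hkX))

lemma finite_tubeCells {n : ℕ} {δ : ℝ} (hδ : δ = (1 / 2) ^ n) {p : Fin 2 → ℤ} {x : Plane}
    (hx : x ∈ gridSquare δ p) (hx1 : x ∈ Metric.closedBall (0 : Plane) 1) {𝒯 : Set (Set Plane)}
    (hT : ∀ T ∈ 𝒯, (T ∩ gridSquare δ p).Nonempty) : (tubeCells δ 𝒯).Finite := by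
  refine (Set.finite_Icc (fun _ : Fin 2 => -(4 * (2 : ℤ) ^ n)) fun _ => 4 * (2 : ℤ) ^ n).subset ?_
  intro k hk
  obtain ⟨⟨h1, h2⟩, h3⟩ := cell_bounds hδ hk.1 hx hx1 (hT _ hk.2)
  have h4 := abs_le.1 h3
  have hp : (0 : ℤ) < 2 ^ n := by positivity
  refine Set.mem_Icc.2 ⟨fun a => ?_, fun a => ?_⟩ <;> fin_cases a <;> simp <;> linarith

lemma nonempty_tubeCells {δ : ℝ} {𝒯 : Set (Set Plane)} (h : 𝒯 ⊆ dyadicTubes δ)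
    (hne : 𝒯.Nonempty) : (tubeCells δ 𝒯).Nonempty := by
  obtain ⟨T, hT⟩ := hne
  obtain ⟨Q, hQ, rfl⟩ := h hT
  obtain ⟨k, rfl⟩ := hQ.1
  exact ⟨k, hQ, hT⟩

/-- Here `Q i` stands for the saturated cells of generation `i`; only covering and `(v +
1)`-dimensional spread are used. The condition `2 - t < v` puts the pair of dimensions `t`, `v + 1`
in the range of the incidence theorem, while `v < s` leaves room for the two pigeonhole losses. -/
theorem exists_generation_weight_ge {t s v : ℝ} (ht : t ≤ 2) (hv : 2 - t < v)
    (hvs : v < s) (hs : s ≤ 1) :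
    ∃ c : ℝ, 0 < c ∧ ∀ (C : ℝ) (μ : Measure Plane) (n : ℕ) (δ : ℝ)
      (𝒯 : Set Plane → Set (Set Plane)) (Q : ℕ → Finset (Fin 2 → ℤ)),
      1 ≤ C →
      μ (Metric.closedBall 0 1)ᶜ = 0 →
      (∀ (x : Plane) (r : ℝ), 0 < r → μ (Metric.closedBall x r) ≤ ENNReal.ofReal (C * r ^ t)) →
      δ = (1 / 2 : ℝ) ^ n →
      (∀ p ∈ dyadicSquaresMeeting δ μ.support,
        𝒯 p ⊆ dyadicTubes δ ∧ (𝒯 p).Nonempty ∧ IsDeltaTubeSet δ s C (𝒯 p) ∧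
        ∀ T ∈ 𝒯 p, (T ∩ p).Nonempty) →
      (∀ p ∈ dyadicSquaresMeeting δ μ.support, ∀ k ∈ tubeCells δ (𝒯 p),
        ∃ i ∈ Finset.range (n + 1), ancestor i k ∈ Q i) →
      (∀ i ∈ Finset.range (n + 1), ∀ (j : ℕ) (y : Fin 2 → ℝ),
        (((Q i).filter fun l => ∀ a, |(l a : ℝ) - y a| ≤ 2 ^ j).card : ℝ) ≤
          72 * ((2 : ℝ) ^ j) ^ (v + 1)) →
      (∀ i ∈ Finset.range (n + 1), ∀ l ∈ Q i, (l 0 : ℝ) * (2 ^ i * δ) ∈ Set.Icc (0 : ℝ) 1) →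
      ∃ i ∈ Finset.range (n + 1),
        c * μ.real Set.univ / C ^ 3 ≤ ((Q i).card : ℝ) * (2 ^ i * δ) ^ (v + 1) := by
  classical
  -- Two pigeonholings each lose `ρ ^ ε`, and the lower bound has exactly `ρ ^ (s - v)` to spare.
  set ε := (s - v) / 2 with hε
  have hε0 : 0 < ε := by rw [hε]; linarith
  set x : ℝ := (1 / 2) ^ ε with hx
  have hx0 : 0 < x := by positivity
  have hx1 : x < 1 := Real.rpow_lt_one (by norm_num) (by norm_num) hε0
  set c₀ := (1 - x) ^ 2 / 2000 with hc₀
  have hc₀pos : 0 < c₀ := by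
    have : 0 < 1 - x := by linarith
    positivity
  have hc₀1 : c₀ ≤ 1 := by
    have h1 : (1 - x) ^ 2 ≤ 1 := pow_le_one₀ (by linarith) (by linarith)
    rw [hc₀]; linarith
  set A := (8 * (1 - (2 : ℝ) ^ (v + 1 - 2))⁻¹ + 6656) *
    (1 - (1 / 2 : ℝ) ^ ((t + (v + 1) - 3) / 2))⁻¹ with hA
  have hA0 : 0 ≤ A := by
    have h1 : (2 : ℝ) ^ (v + 1 - 2) < 1 :=
      Real.rpow_lt_one_of_one_lt_of_neg one_lt_two (by linarith)
    have h2 : (1 / 2 : ℝ) ^ ((t + (v + 1) - 3) / 2) < 1 :=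
      Real.rpow_lt_one (by norm_num) (by norm_num) (by linarith)
    have h3 : 0 ≤ (1 - (2 : ℝ) ^ (v + 1 - 2))⁻¹ := inv_nonneg.2 (by linarith)
    have h4 : 0 ≤ (1 - (1 / 2 : ℝ) ^ ((t + (v + 1) - 3) / 2))⁻¹ := inv_nonneg.2 (by linarith)
    positivity
  refine ⟨(c₀ / (1 + 34 * A)) ^ 2, by positivity, ?_⟩
  intro C μ n δ 𝒯 Q hC hμ hball hδ h𝒯 hQcover hQbox hQ0
  have hδ0 : 0 < δ := by rw [hδ]; positivity
  have hC0 : 0 < C := by linarith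
  have hfinite : IsFiniteMeasure μ :=
    ⟨(measure_univ_le hμ hball).trans_lt ENNReal.ofReal_lt_top⟩
  set M := μ.real Set.univ with hM
  have hMC : M ≤ C := ENNReal.toReal_le_of_le_ofReal hC0.le (measure_univ_le hμ hball)
  rcases (measureReal_nonneg : 0 ≤ M).eq_or_lt with hM0 | hMpos
  · refine ⟨0, by simp, ?_⟩
    rw [hM, ← hM0, mul_zero, zero_div]; positivity
  have hsupp := support_subset_closedBall hμ
  set X := (finite_cells_meeting hδ hsupp).toFinset with hX
  have hXmem : ∀ k, k ∈ X ↔ (gridSquare δ k ∩ μ.support).Nonempty := fun k => by simp [hX]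
  have hXD : ∀ k ∈ X, gridSquare δ k ∈ dyadicSquaresMeeting δ μ.support := fun k hk =>
    ⟨⟨k, rfl⟩, (hXmem k).1 hk⟩
  choose! f hf using fun k (hk : k ∈ X) => (hXmem k).1 hk
  have hfsq : ∀ k ∈ X, f k ∈ gridSquare δ k := fun k hk => (hf k hk).1
  have hf1 : ∀ k ∈ X, f k ∈ Metric.closedBall (0 : Plane) 1 := fun k hk => hsupp (hf k hk).2
  have hsum : ∑ k ∈ X, μ.real (gridSquare δ k) = M := sum_measureReal_gridSquare hδ0 hXmem
  have hα := sum_geometric_weights_le hx0.le n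
  -- The first pigeonhole: `h k` is a generation at which the tubes of the square `k` meet many
  -- cells of `Q`.
  choose! h hh using fun k (hk : k ∈ X) => exists_generation_card_ge hδ0 hC0.le
    (finite_tubeCells hδ (hfsq k hk) (hf1 k hk) (h𝒯 _ (hXD k hk)).2.2.2)
    (nonempty_tubeCells (h𝒯 _ (hXD k hk)).1 (h𝒯 _ (hXD k hk)).2.1) (h𝒯 _ (hXD k hk)).2.2.1
    (hQcover _ (hXD k hk)) hα
  -- The second pigeonhole, by mass: a single generation serves squares carrying a proportion of at
  -- least its geometric weight.
  obtain ⟨i, hi, hiM⟩ : ∃ i ∈ Finset.range (n + 1), (1 - x) * x ^ (n - i) * M ≤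
      ∑ k ∈ X with h k = i, μ.real (gridSquare δ k) := by
    refine Finset.exists_le_of_sum_le ⟨0, by simp⟩ ?_
    rw [Finset.sum_fiberwise_of_maps_to fun k hk => (hh k hk).1, hsum, ← Finset.sum_mul]
    exact mul_le_of_le_one_left hMpos.le hα
  refine ⟨i, hi, ?_⟩
  have hin : i ≤ n := by have := Finset.mem_range.1 hi; omega
  set ρ := 2 ^ i * δ with hρ
  have hρ0 : 0 < ρ := by positivity
  have hρn : ρ = (1 / 2) ^ (n - i) := by
    have h2 : (1 / 2 : ℝ) ^ n = (1 / 2) ^ i * (1 / 2) ^ (n - i) := by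
      rw [← pow_add]; congr 1; omega
    rw [hρ, hδ, h2, ← mul_assoc, ← mul_pow]
    norm_num
  have hδρ : δ ≤ ρ := by
    have : (1 : ℝ) ≤ 2 ^ i := one_le_pow₀ one_le_two
    rw [hρ]; nlinarith
  have hxρ : x ^ (n - i) = ρ ^ ε := by
    rw [hρn, hx, ← Real.rpow_natCast, ← Real.rpow_mul (by norm_num), mul_comm,
      Real.rpow_mul (by norm_num), Real.rpow_natCast]
  set α := (1 - x) * x ^ (n - i) with hαdef
  have hαpos : 0 < α := by
    have : 0 < 1 - x := by linarith
    positivity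
  have hs0 : 0 < (2 * ρ) ^ s := by positivity
  set X' := X.filter fun k => h k = i with hX'
  have hN : ∀ k ∈ X', α / (C * (2 * ρ) ^ s) ≤ (((Q i).filter fun l =>
      (gridSquare ρ l ∩ paramUnion δ (𝒯 (gridSquare δ k))).Nonempty).card : ℝ) := by
    intro k hk
    obtain ⟨hkX, hki⟩ := Finset.mem_filter.1 hk
    have h1 := (hh k hkX).2
    rw [hki] at h1
    rw [div_le_iff₀ (by positivity)]
    exact h1
  have hlow := le_smoothedIncidence (u := v + 1) hρ0 hδρ (Finset.filter_subset (fun k => h k = i) X)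
    (m := fun k => μ.real (gridSquare δ k)) (fun k _ => measureReal_nonneg) hfsq hf1
    (fun k hk => (h𝒯 _ (hXD k hk)).2.2.2) hN
  -- All powers of `ρ` cancel because `2 ε + v = s`. The constant `2000` in `c₀` is `1000` from the
  -- kernel times `2 ≥ 2 ^ s`.
  have hlow2 : c₀ * M / C ≤ (∑ k ∈ X', μ.real (gridSquare δ k)) *
      (α / (C * (2 * ρ) ^ s) * (ρ ^ (v + 1) * (1000 * ρ)⁻¹)) := by
    have h1 : (2 * ρ) ^ s ≤ 2 * ρ ^ s := by
      rw [Real.mul_rpow two_pos.le hρ0.le]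
      gcongr
      calc (2 : ℝ) ^ s ≤ 2 ^ (1 : ℝ) := Real.rpow_le_rpow_of_exponent_le one_le_two hs
        _ = 2 := Real.rpow_one 2
    have h2 : ρ ^ ε * ρ ^ ε * ρ ^ (v + 1) = ρ ^ s * ρ := by
      rw [← Real.rpow_add hρ0, ← Real.rpow_add hρ0]
      nth_rw 3 [← Real.rpow_one ρ]
      rw [← Real.rpow_add hρ0]
      congr 1
      rw [hε]; ring
    calc c₀ * M / C = (α * M) * (α / (C * (2 * ρ ^ s)) * (ρ ^ (v + 1) * (1000 * ρ)⁻¹)) := by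
          rw [hαdef, hxρ, hc₀]
          have h3 : ρ ^ s ≠ 0 := by positivity
          field_simp
          linear_combination (-2000 * M * (1 - x) ^ 2) * h2
      _ ≤ _ := by gcongr
  have hQi : 0 < (Q i).card := by
    rw [Finset.card_pos]
    by_contra hemp
    rw [Finset.not_nonempty_iff_eq_empty] at hemp
    have hXne : X'.Nonempty := by
      by_contra hX'emp
      rw [Finset.not_nonempty_iff_eq_empty] at hX'emp
      rw [hX'emp, Finset.sum_empty] at hiM
      have : 0 < α * M := by positivity
      linarith
    obtain ⟨k, hk⟩ := hXne
    have h1 := hN k hk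
    rw [hemp] at h1
    simp at h1
    have : 0 < α / (C * (2 * ρ) ^ s) := by positivity
    linarith
  have hQ0i : ∀ l ∈ Q i, (l 0 : ℝ) * ρ ∈ Set.Icc (0 : ℝ) 1 := hQ0 i hi
  clear_value ρ
  have hup := smoothedIncidence_le (X := X) (Y := Q i) (a := fun k => f k 0) (b := fun k => f k 1)
    (m := fun k => μ.real (gridSquare δ k)) (θ := fun l : Fin 2 → ℤ => (l 0 : ℝ) * ρ) (r := fun l : Fin 2 → ℤ => (l 1 : ℝ) * ρ)
    (w := fun _ => ρ ^ (v + 1)) (t := t) (u := v + 1) (C := 16 * C) (B := 72) (n - i) ht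
    (by linarith) (by linarith) (by positivity) (by norm_num)
    (fun k hk => coord_sq_le_one (hf1 k hk)) (fun k _ => measureReal_nonneg)
    (fun _ _ => by positivity) hQ0i
    (fun k _ e => by
      rw [← hρn]
      refine sum_measureReal_near_le hδ0 ?_ hC0.le ht hball hfsq (f k)
      have : (1 : ℝ) ≤ 2 ^ e := one_le_pow₀ one_le_two
      nlinarith)
    (fun l _ e => by
      rw [← hρn, Finset.sum_const, nsmul_eq_mul, Real.mul_rpow (by positivity) hρ0.le,
        ← mul_assoc (72 : ℝ)]
      refine mul_le_mul_of_nonneg_right ?_ (Real.rpow_nonneg hρ0.le _)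
      refine le_trans ?_ (hQbox i hi e fun a => l a)
      norm_cast
      refine Finset.card_le_card fun l' hl' => ?_
      obtain ⟨h1, h2⟩ := Finset.mem_filter.1 hl'
      refine Finset.mem_filter.2 ⟨h1, fun a => ?_⟩
      rw [max_le_iff, ← sub_mul, ← sub_mul, abs_mul, abs_mul, abs_of_pos hρ0,
        mul_le_mul_iff_left₀ hρ0, mul_le_mul_iff_left₀ hρ0] at h2
      push_cast at h2
      have h3 : ∀ a, |(l a : ℝ) - l' a| ≤ 2 ^ e := Fin.forall_fin_two.2 h2
      have := h3 a
      rw [abs_sub_comm] at this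
      exact_mod_cast this)
    (by rw [hsum]; exact hMpos)
    (by rw [Finset.sum_const, nsmul_eq_mul]; positivity)
  rw [← hρn, hsum, Finset.sum_const, nsmul_eq_mul] at hup
  exact le_of_le_add_sqrt hc₀pos hc₀1 hA0 hMpos (by positivity) hC hMC
    (hlow2.trans (hlow.trans hup))

end Generation

end Furstenberg

/-! ### Coinciding tubes, the Katz–Tao property and Hausdorff content -/

namespace Furstenberg

section Fibers

/-- A point of the line `ℓ_{θ,r}`, at signed distance `X` from the foot of the perpendicular. -/
noncomputable def linePoint (θ r X : ℝ) : Plane :=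
  !₂[r * Real.cos (2 * Real.pi * θ) - X * Real.sin (2 * Real.pi * θ),
    r * Real.sin (2 * Real.pi * θ) + X * Real.cos (2 * Real.pi * θ)]

lemma proj_linePoint (θ' θ r X : ℝ) : proj θ' (linePoint θ r X) =
    r * Real.cos (2 * Real.pi * (θ' - θ)) + X * Real.sin (2 * Real.pi * (θ' - θ)) := by
  rw [mul_sub, Real.cos_sub, Real.sin_sub]
  simp [proj, linePoint]
  ring

/-- Equality of tubes as point sets is exploited by testing on individual points of a line; `X` says
how far out on the line the test point lies. -/
lemma exists_mem_of_tube_eq {Q Q' : Set Plane} (h : tube Q = tube Q') {q : Plane} (hq : q ∈ Q)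
    (X : ℝ) : ∃ q' ∈ Q', q 1 * Real.cos (2 * Real.pi * (q' 0 - q 0)) +
      X * Real.sin (2 * Real.pi * (q' 0 - q 0)) = q' 1 := by
  have h1 : linePoint (q 0) (q 1) X ∈ tube Q := by
    refine Set.mem_biUnion hq ?_
    change proj _ _ = _
    rw [proj_linePoint]; simp
  rw [h] at h1
  simp only [tube, Set.mem_iUnion] at h1
  obtain ⟨q', hq', hq1⟩ := h1
  refine ⟨q', hq', ?_⟩
  change proj _ _ = _ at hq1
  rwa [proj_linePoint] at hq1

/-- The parameters of coinciding tubes agree, up to `O(δ)`, modulo `(θ, r) ↦ (θ + 1/2, -r)`. -/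
lemma corner_close_of_tube_eq {δ : ℝ} (hδ : 0 < δ) (hδ1 : δ ≤ 1) {k k' : Fin 2 → ℤ}
    (hk : gridSquare δ k ∈ paramSquares δ) (hk' : gridSquare δ k' ∈ paramSquares δ)
    (hb : |(k 1 : ℝ) * δ| ≤ 4) (hb' : |(k' 1 : ℝ) * δ| ≤ 4)
    (h : tube (gridSquare δ k) = tube (gridSquare δ k')) :
    ∃ i ∈ Finset.Icc (-2 : ℤ) 2, ∃ e ∈ ({1, -1} : Finset ℤ),
      |(k' 0 : ℝ) * δ - (k 0 * δ + i / 2)| ≤ 64 * δ ∧ |(k' 1 : ℝ) * δ - e * (k 1 * δ)| ≤ 64 * δ := by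
  have hpi := Real.pi_pos
  have hpi2 := Real.pi_lt_d2
  have hc := corner_mem_gridSquare hδ k
  have hθ := hk.2 _ hc
  -- The test point at distance `10 / δ` forces the angles to agree modulo `1 / 2` up to `δ`, since
  -- all the offsets are bounded by constants. The test point at the foot of the perpendicular then
  -- compares the offsets up to sign.
  obtain ⟨q, hq, hq1⟩ := exists_mem_of_tube_eq h hc (10 / δ)
  obtain ⟨q', hq', hq1'⟩ := exists_mem_of_tube_eq h hc 0
  have hqθ := hk'.2 q hq
  simp only [corner_apply, zero_mul, add_zero] at hθ hq1 hq1'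
  set θ := (k 0 : ℝ) * δ with hθdef
  set r := (k 1 : ℝ) * δ with hrdef
  have a0 := abs_sub_corner_le hq 0
  have a1 := abs_sub_corner_le hq 1
  have a1' := abs_sub_corner_le hq' 1
  have b0 := abs_sub_le_of_mem_gridSquare hq' hq 0
  set α := q 0 - θ with hα
  have hsin : |Real.sin (2 * Real.pi * α)| ≤ δ := by
    have h1 : 10 / δ * Real.sin (2 * Real.pi * α) = q 1 - r * Real.cos (2 * Real.pi * α) := by
      linarith
    have h2 : |10 / δ * Real.sin (2 * Real.pi * α)| ≤ 10 := by
      rw [h1]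
      have h3 : |r * Real.cos (2 * Real.pi * α)| ≤ 4 := by
        rw [abs_mul]
        exact (mul_le_of_le_one_right (abs_nonneg _) (Real.abs_cos_le_one _)).trans hb
      rw [abs_le] at *
      constructor <;> linarith
    rw [abs_mul, abs_of_pos (by positivity : 0 < 10 / δ), div_mul_eq_mul_div, div_le_iff₀ hδ] at h2
    linarith
  -- Rounding `2α` selects the nearest half-turn; `|α| < 1` leaves only `-2 ≤ i ≤ 2`.
  set i := round (2 * α) with hi
  set β := α - i / 2 with hβ
  have hround := abs_sub_round (2 * α)
  rw [← hi] at hround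
  have hβ4 : |β| ≤ 1 / 4 := by
    have : β = (2 * α - i) / 2 := by rw [hβ]; ring
    rw [this, abs_div, abs_two]; linarith
  have hβδ : |β| ≤ δ := by
    have h1 : 2 * Real.pi * α = 2 * Real.pi * β + i * Real.pi := by rw [hβ]; ring
    rw [h1, Real.sin_add_int_mul_pi, abs_mul, abs_zpow, abs_neg, abs_one, one_zpow, one_mul] at hsin
    have h2 := Real.mul_abs_le_abs_sin (x := 2 * Real.pi * β) (by
      rw [abs_mul, abs_of_pos Real.two_pi_pos]; nlinarith)
    rw [abs_mul, abs_of_pos Real.two_pi_pos] at h2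
    have h3 : 2 / Real.pi * (2 * Real.pi * |β|) = 4 * |β| := by field_simp; ring
    linarith [abs_nonneg β]
  have hi2 : -2 ≤ i ∧ i ≤ 2 := by
    have h1 : -1 < α ∧ α < 1 := ⟨by linarith [hqθ.1, hθ.2], by linarith [hqθ.2, hθ.1]⟩
    rw [abs_le] at hround
    constructor
    · have : (-3 : ℝ) < i := by linarith [h1.1]
      have : (-3 : ℤ) < i := by exact_mod_cast this
      omega
    · have : (i : ℝ) < 3 := by linarith [h1.2]
      have : i < (3 : ℤ) := by exact_mod_cast this
      omega
  have hcos : |q' 1 - ((-1 : ℝ) ^ i) * r| ≤ 51 * δ := by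
    set β' := q' 0 - θ - i / 2 with hβ'
    have h1 : |β'| ≤ 2 * δ := by
      have : β' = (q' 0 - q 0) + β := by rw [hβ', hβ, hα]; ring
      rw [this]
      exact (abs_add_le _ _).trans (by linarith)
    have h2 : 2 * Real.pi * (q' 0 - θ) = 2 * Real.pi * β' + i * Real.pi := by rw [hβ']; ring
    rw [h2, Real.cos_add_int_mul_pi] at hq1'
    have h3 : q' 1 - ((-1 : ℝ) ^ i) * r =
        ((-1 : ℝ) ^ i) * (r * (Real.cos (2 * Real.pi * β') - Real.cos 0)) := by
      rw [← hq1', Real.cos_zero]; ring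
    rw [h3, abs_mul, abs_zpow, abs_neg, abs_one, one_zpow, one_mul, abs_mul]
    have h4 := Real.abs_cos_sub_cos_le (2 * Real.pi * β') 0
    rw [sub_zero, abs_mul, abs_of_pos Real.two_pi_pos] at h4
    calc _ ≤ 4 * (2 * 3.15 * (2 * δ)) := by
          refine mul_le_mul hb (h4.trans ?_) (abs_nonneg _) (by norm_num)
          gcongr
      _ ≤ 51 * δ := by nlinarith
  refine ⟨i, Finset.mem_Icc.2 hi2, ((-1) ^ i.natAbs : ℤ), ?_, ?_, ?_⟩
  · rcases neg_one_pow_eq_or ℤ i.natAbs with h | h <;> simp [h]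
  · have : (k' 0 : ℝ) * δ - (θ + i / 2) = β - (q 0 - k' 0 * δ) := by rw [hβ, hα]; ring
    rw [this]
    exact (abs_sub _ _).trans (by linarith)
  · have he : (((-1 : ℤ) ^ i.natAbs : ℤ) : ℝ) = (-1 : ℝ) ^ i := by
      push_cast
      rcases Int.natAbs_eq i with h | h
      · nth_rw 2 [h]; rw [zpow_natCast]
      · nth_rw 2 [h]; rw [zpow_neg, zpow_natCast, ← inv_pow]; norm_num
    rw [he]
    have : (k' 1 : ℝ) * δ - (-1) ^ i * r = (q' 1 - (-1) ^ i * r) - (q' 1 - k' 1 * δ) := by ring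
    rw [this]
    exact (abs_sub _ _).trans (by linarith)

/-- The integer points within sup-distance `64` of `y`. -/
noncomputable def intBox (y : Fin 2 → ℝ) : Finset (Fin 2 → ℤ) :=
  Fintype.piFinset fun a => Finset.Icc ⌈y a - 64⌉ ⌊y a + 64⌋

lemma mem_intBox {y : Fin 2 → ℝ} {k : Fin 2 → ℤ} : k ∈ intBox y ↔ ∀ a, |(k a : ℝ) - y a| ≤ 64 := by
  simp only [intBox, Fintype.mem_piFinset, Finset.mem_Icc, Int.ceil_le, Int.le_floor, abs_le]
  refine forall_congr' fun a => ?_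
  constructor <;> rintro ⟨h1, h2⟩ <;> constructor <;> linarith

lemma card_intBox_le (y : Fin 2 → ℝ) : (intBox y).card ≤ 16641 := by
  have h : ∀ a, (Finset.Icc ⌈y a - 64⌉ ⌊y a + 64⌋).card ≤ 129 := fun a => by
    rw [Int.card_Icc]
    have h1 := Int.floor_le (y a + 64)
    have h2 := Int.le_ceil (y a - 64)
    have h3 : ((⌊y a + 64⌋ : ℤ) : ℝ) ≤ ((⌈y a - 64⌉ + 128 : ℤ) : ℝ) := by push_cast; linarith
    have h4 : ⌊y a + 64⌋ ≤ ⌈y a - 64⌉ + 128 := by exact_mod_cast h3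
    omega
  rw [intBox, Fintype.card_piFinset, Fin.prod_univ_two]
  exact (Nat.mul_le_mul (h 0) (h 1)).trans (by norm_num)

/-- The index set of the parameter symmetries `(θ, r) ↦ (θ + i / 2, e r)`. -/
noncomputable def symmetryIndices : Finset (ℤ × ℤ) := Finset.Icc (-2) 2 ×ˢ {1, -1}

lemma card_symmetryIndices : symmetryIndices.card = 10 := by
  rw [symmetryIndices, Finset.card_product]; decide

/-- The image of the cell index `k` under a parameter symmetry. -/
noncomputable def symmetricCell (δ : ℝ) (g : ℤ × ℤ) (k : Fin 2 → ℤ) : Fin 2 → ℝ :=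
  ![k 0 + g.1 / (2 * δ), g.2 * k 1]

lemma exists_mem_intBox_of_tube_eq {δ : ℝ} (hδ : 0 < δ) (hδ1 : δ ≤ 1) {k k' : Fin 2 → ℤ}
    (hk : gridSquare δ k ∈ paramSquares δ) (hk' : gridSquare δ k' ∈ paramSquares δ)
    (hb : |(k 1 : ℝ) * δ| ≤ 4) (hb' : |(k' 1 : ℝ) * δ| ≤ 4)
    (h : tube (gridSquare δ k) = tube (gridSquare δ k')) :
    ∃ g ∈ symmetryIndices, k' ∈ intBox (symmetricCell δ g k) := by
  obtain ⟨i, hi, e, he, h0, h1⟩ := corner_close_of_tube_eq hδ hδ1 hk hk' hb hb' h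
  refine ⟨(i, e), Finset.mem_product.2 ⟨hi, he⟩, mem_intBox.2 (Fin.forall_fin_two.2 ⟨?_, ?_⟩)⟩
  · refine le_of_mul_le_mul_right (a := δ) ?_ hδ
    rw [← abs_of_pos hδ, ← abs_mul, abs_of_pos hδ]
    refine le_trans (le_of_eq ?_) h0
    congr 1
    simp [symmetricCell]
    field_simp
  · refine le_of_mul_le_mul_right (a := δ) ?_ hδ
    rw [← abs_of_pos hδ, ← abs_mul, abs_of_pos hδ]
    refine le_trans (le_of_eq ?_) h1
    congr 1
    simp [symmetricCell]
    ring

lemma exists_two_pow_near {y : ℝ} (hy : 1 ≤ y) : ∃ j : ℕ, y ≤ 2 ^ j ∧ (2 : ℝ) ^ j ≤ 2 * y := by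
  obtain ⟨j, h1, h2⟩ := exists_nat_pow_near hy one_lt_two
  exact ⟨j + 1, h2.le, by rw [pow_succ]; linarith⟩

lemma card_box_le_rpow {S' : Finset (Fin 2 → ℤ)} {u : ℝ} (hu : 0 ≤ u)
    (h : ∀ (i : ℕ) (y : Fin 2 → ℝ),
      ((S'.filter fun k => ∀ a, |(k a : ℝ) - y a| ≤ 2 ^ i).card : ℝ) ≤ 9 * ((2 : ℝ) ^ i) ^ u)
    {X : Finset (Fin 2 → ℤ)} (hX : X ⊆ S') (y : Fin 2 → ℝ) {R : ℝ} (hR : 1 ≤ R)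
    (hXR : ∀ k ∈ X, ∀ a, |(k a : ℝ) - y a| ≤ R) : (X.card : ℝ) ≤ 9 * (2 * R) ^ u := by
  obtain ⟨j, h1, h2⟩ := exists_two_pow_near hR
  calc (X.card : ℝ) ≤ ((S'.filter fun k => ∀ a, |(k a : ℝ) - y a| ≤ 2 ^ j).card : ℝ) := by
        exact_mod_cast Finset.card_le_card fun k hk =>
          Finset.mem_filter.2 ⟨hX hk, fun a => (hXR k hk a).trans h1⟩
    _ ≤ 9 * ((2 : ℝ) ^ j) ^ u := h j y
    _ ≤ 9 * (2 * R) ^ u := by gcongr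

/-- The parameter set of a family of tubes includes every cell giving one of those tubes, not just
the cells of `S'`. These extra cells lie within `64` of one of ten symmetric images of a cell in
`S'`, so a ball costs ten boxes of cells of `S'`, each cell counted at most `16641 = 129²` times;
`17424` is `(2 * 66)²`. The hypothesis `hfib` ensures that the extra cells also have bounded
offsets. -/
lemma isKatzTaoTubeSet_image {δ u : ℝ} (hδ : 0 < δ) (hδ1 : δ ≤ 1) (hu : 0 ≤ u) (hu2 : u ≤ 2)
    {S S' : Finset (Fin 2 → ℤ)} (hS'S : S' ⊆ S)
    (hS : ∀ k ∈ S, gridSquare δ k ∈ paramSquares δ ∧ |(k 1 : ℝ) * δ| ≤ 4)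
    (hfib : ∀ k, k ∈ tubeCells δ ((fun k => tube (gridSquare δ k)) '' S') → k ∈ S)
    (h : ∀ (i : ℕ) (y : Fin 2 → ℝ),
      ((S'.filter fun k => ∀ a, |(k a : ℝ) - y a| ≤ 2 ^ i).card : ℝ) ≤ 9 * ((2 : ℝ) ^ i) ^ u) :
    IsKatzTaoTubeSet δ u (10 * 9 * 17424 * 16641)
      ((fun k => tube (gridSquare δ k)) '' S') := by
  classical
  intro x r hr
  have hR : 1 ≤ r / δ := by rwa [one_le_div hδ]
  set R := r / δ with hRdef
  -- The centre of the ball, in units of `δ`, pulled back by the symmetry `g`. The radius `66 R`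
  -- below absorbs `R + 1` for the ball and cell, and `64` for the box.
  set y : ℤ × ℤ → Fin 2 → ℝ := fun g =>
    ![x 0 / δ - g.1 / (2 * δ), g.2 * (x 1 / δ)] with hy
  set B : Finset (Fin 2 → ℤ) := symmetryIndices.biUnion fun g =>
    (S'.filter fun k => ∀ a, |(k a : ℝ) - y g a| ≤ 66 * R).biUnion
      fun k => intBox (symmetricCell δ g k) with hB
  have hcover : paramUnion δ ((fun k => tube (gridSquare δ k)) '' S') ∩ Metric.closedBall x r ⊆
      ⋃ k ∈ B, gridSquare δ k := by
    rintro q ⟨hq, hqx⟩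
    rw [paramUnion_eq, Set.mem_iUnion₂] at hq
    obtain ⟨k', hk', hqk'⟩ := hq
    have hk'S := hS k' (hfib k' hk')
    obtain ⟨k, hkS', hkk'⟩ := hk'.2
    have hkS := hS k (hS'S hkS')
    obtain ⟨g, hg, hgk⟩ := exists_mem_intBox_of_tube_eq hδ hδ1 hkS.1 hk'S.1 hkS.2 hk'S.2 hkk'
    refine Set.mem_biUnion (x := k') ?_ hqk'
    rw [Finset.mem_coe, hB, Finset.mem_biUnion]
    refine ⟨g, hg, Finset.mem_biUnion.2 ⟨k, Finset.mem_filter.2 ⟨hkS', ?_⟩, hgk⟩⟩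
    have hbox := mem_intBox.1 hgk
    have hdist : ∀ a, |(k' a : ℝ) - x a / δ| ≤ R + 1 := fun a => by
      have h1 := abs_sub_corner_le hqk' a
      have h2 := (abs_sub_le_dist q x a).trans (Metric.mem_closedBall.1 hqx)
      refine le_of_mul_le_mul_right (a := δ) ?_ hδ
      have e : ∀ z : ℝ, |z| * δ = |z * δ| := fun z => by rw [abs_mul, abs_of_pos hδ]
      rw [e, sub_mul, div_mul_cancel₀ _ hδ.ne', add_mul, hRdef, div_mul_cancel₀ _ hδ.ne',
        one_mul]
      rw [abs_le] at *
      constructor <;> linarith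
    have h0 := hbox 0
    have h1 := hbox 1
    have d0 := hdist 0
    have d1 := hdist 1
    simp only [symmetricCell, Matrix.cons_val_zero, Matrix.cons_val_one] at h0 h1
    have he : (g.2 : ℝ) = 1 ∨ (g.2 : ℝ) = -1 := by
      have := (Finset.mem_product.1 hg).2
      simp only [Finset.mem_insert, Finset.mem_singleton] at this
      rcases this with h | h <;> simp [h]
    refine Fin.forall_fin_two.2 ⟨?_, ?_⟩
    · simp only [hy, Matrix.cons_val_zero]
      rw [abs_le] at *
      constructor <;> linarith
    · simp only [hy, Matrix.cons_val_one, Matrix.cons_val_zero]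
      rcases he with he | he <;> rw [he] at h1 ⊢ <;> rw [abs_le] at * <;> constructor <;> linarith
  have hfilter : ∀ g, ((S'.filter fun k => ∀ a, |(k a : ℝ) - y g a| ≤ 66 * R).card : ℝ) ≤
      9 * (17424 * R ^ u) := fun g => by
    refine (card_box_le_rpow hu h (Finset.filter_subset _ _) (y g) (R := 66 * R) (by linarith)
      fun k hk => (Finset.mem_filter.1 hk).2).trans ?_
    rw [← mul_assoc, Real.mul_rpow (by norm_num) (by linarith)]
    gcongr
    calc ((2 : ℝ) * 66) ^ u ≤ (2 * 66) ^ (2 : ℝ) :=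
          Real.rpow_le_rpow_of_exponent_le (by norm_num) hu2
      _ = 17424 := by norm_num
  have hBcard : (B.card : ℝ) ≤ 10 * 9 * 17424 * 16641 * R ^ u := by
    have h1 : (B.card : ℝ) ≤ ∑ g ∈ symmetryIndices,
        ((S'.filter fun k => ∀ a, |(k a : ℝ) - y g a| ≤ 66 * R).card : ℝ) * 16641 := by
      have := Finset.card_biUnion_le (s := symmetryIndices) (t := fun g =>
        (S'.filter fun k => ∀ a, |(k a : ℝ) - y g a| ≤ 66 * R).biUnion
          fun k => intBox (symmetricCell δ g k))
      refine le_trans (Nat.cast_le.2 this) ?_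
      push_cast
      refine Finset.sum_le_sum fun g _ => ?_
      have := Finset.card_biUnion_le_card_mul
        (S'.filter fun k => ∀ a, |(k a : ℝ) - y g a| ≤ 66 * R)
        (fun k => intBox (symmetricCell δ g k)) 16641 fun k _ => card_intBox_le _
      exact_mod_cast this
    refine h1.trans ?_
    calc _ ≤ ∑ _g ∈ symmetryIndices, 9 * (17424 * R ^ u) * 16641 :=
          Finset.sum_le_sum fun g _ => mul_le_mul_of_nonneg_right (hfilter g) (by norm_num)
      _ = _ := by rw [Finset.sum_const, card_symmetryIndices]; simp only [nsmul_eq_mul]; push_cast; ring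
  calc _ ≤ ∑ k ∈ B, covNum δ (gridSquare δ k) := (covNum_mono hcover).trans (covNum_biUnion_le _ _)
    _ ≤ ∑ _k ∈ B, 1 := Finset.sum_le_sum fun k _ => covNum_gridSquare_le_one hδ k
    _ = ENNReal.ofReal (B.card : ℝ) := by simp
    _ ≤ _ := ENNReal.ofReal_le_ofReal hBcard

/-- At most `10 * 16641` cells can define the same tube, by the same box count. -/
lemma card_le_mul_encard_image {δ : ℝ} (hδ : 0 < δ) (hδ1 : δ ≤ 1) {S' : Finset (Fin 2 → ℤ)}
    (hS : ∀ k ∈ S', gridSquare δ k ∈ paramSquares δ ∧ |(k 1 : ℝ) * δ| ≤ 4) :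
    (S'.card : ℝ≥0∞) ≤ 166410 * (((fun k => tube (gridSquare δ k)) '' (S' : Set _)).encard : ℝ≥0∞) := by
  classical
  have h1 := Finset.card_le_mul_card_image (f := fun k => tube (gridSquare δ k)) S' 166410 (by
    intro T hT
    obtain ⟨k, hk, rfl⟩ := Finset.mem_image.1 hT
    have hsub : (S'.filter fun k' => tube (gridSquare δ k') = tube (gridSquare δ k)) ⊆
        symmetryIndices.biUnion fun g => intBox (symmetricCell δ g k) := fun k' hk' => by
      obtain ⟨hk'S, hkk'⟩ := Finset.mem_filter.1 hk'
      obtain ⟨g, hg, hgk⟩ := exists_mem_intBox_of_tube_eq hδ hδ1 (hS k hk).1 (hS k' hk'S).1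
        (hS k hk).2 (hS k' hk'S).2 hkk'.symm
      exact Finset.mem_biUnion.2 ⟨g, hg, hgk⟩
    refine (Finset.card_le_card hsub).trans ((Finset.card_biUnion_le_card_mul _ _ 16641
      fun g _ => card_intBox_le _).trans ?_)
    rw [card_symmetryIndices])
  rw [← Finset.coe_image, Set.encard_coe_eq_coe_finsetCard]
  push_cast
  exact_mod_cast h1

/-- Mass distribution principle for well-spread sets of squares. -/
lemma le_hausdorffContent {δ u : ℝ} (hδ : 0 < δ) (hu : 0 ≤ u) {S' : Finset (Fin 2 → ℤ)}
    {E : Set Plane} (hE : ∀ k ∈ S', corner δ k ∈ E)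
    (h : ∀ (i : ℕ) (y : Fin 2 → ℝ),
      ((S'.filter fun k => ∀ a, |(k a : ℝ) - y a| ≤ 2 ^ i).card : ℝ) ≤ 9 * ((2 : ℝ) ^ i) ^ u) :
    ENNReal.ofReal (S'.card * δ ^ u / 9) ≤ hausdorffContent δ u E := by
  classical
  unfold hausdorffContent
  refine le_iInf fun 𝓑 => le_iInf fun _ => le_iInf fun hr => le_iInf fun hcov => ?_
  -- Assign each corner to one covering ball containing it. The spread of `S'` bounds the number
  -- assigned to a ball by its contribution times `9 / δ ^ u`, and only finitely many balls are
  -- used.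
  have hex : ∀ k ∈ S', ∃ b : 𝓑, corner δ k ∈ Metric.closedBall (b : Plane × ℝ).1 (b : Plane × ℝ).2 :=
    fun k hk => by
      have := hcov (hE k hk)
      rw [Set.mem_iUnion₂] at this
      obtain ⟨b, hb, hkb⟩ := this
      exact ⟨⟨b, hb⟩, hkb⟩
  rcases S'.eq_empty_or_nonempty with rfl | ⟨k₀, hk₀⟩
  · simp
  have : Nonempty 𝓑 := ⟨(hex k₀ hk₀).choose⟩
  choose! g hg using hex
  refine le_trans ?_ (ENNReal.sum_le_tsum (S'.image g))
  rw [← ENNReal.ofReal_sum_of_nonneg fun b _ => by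
    have := hr b b.2
    exact Real.rpow_nonneg (by linarith) _]
  refine ENNReal.ofReal_le_ofReal ?_
  rw [div_le_iff₀ (by norm_num), Finset.card_eq_sum_card_fiberwise (f := g) (t := S'.image g)
    fun k hk => Finset.mem_image_of_mem g hk]
  push_cast
  rw [Finset.sum_mul, Finset.sum_mul]
  refine Finset.sum_le_sum fun b _ => ?_
  have hb := hr b b.2
  have hR : 1 ≤ (b : Plane × ℝ).2 / δ := by rwa [one_le_div hδ]
  have h1 := card_box_le_rpow hu h (Finset.filter_subset (fun k => g k = b) S')
    (fun a => (b : Plane × ℝ).1 a / δ) hR fun k hk a => by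
      obtain ⟨hkS, hkb⟩ := Finset.mem_filter.1 hk
      have h2 := hg k hkS
      rw [hkb, Metric.mem_closedBall] at h2
      have h3 := (abs_sub_le_dist _ _ a).trans h2
      rw [corner_apply] at h3
      rw [le_div_iff₀ hδ]
      nth_rw 2 [← abs_of_pos hδ]
      rw [← abs_mul, sub_mul, div_mul_cancel₀ _ hδ.ne']
      exact h3
  have h4 : (2 * ((b : Plane × ℝ).2 / δ)) ^ u * δ ^ u = (2 * (b : Plane × ℝ).2) ^ u := by
    rw [← Real.mul_rpow (by linarith) hδ.le, mul_assoc, div_mul_cancel₀ _ hδ.ne']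
  calc _ ≤ 9 * (2 * ((b : Plane × ℝ).2 / δ)) ^ u * δ ^ u := by gcongr
    _ = _ := by rw [mul_assoc, h4, mul_comm]

end Fibers

end Furstenberg

/-! ### Assembly of the main theorem -/

namespace Furstenberg

section Main

open MeasureTheory

/-- The real-variable core of the main theorem: a well-spread set of parameter squares that is
large. -/
theorem exists_large_spread_cells {t s σ : ℝ} (ht : t ≤ 2) (hst : 2 - t < s) (hs : s ≤ 1)
    (hσ0 : 0 ≤ σ) (hσs : σ < s) :
    ∃ c : ℝ, 0 < c ∧ ∀ (C : ℝ) (μ : Measure Plane) (n : ℕ) (δ : ℝ)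
      (𝒯 : Set Plane → Set (Set Plane)),
      1 ≤ C →
      μ (Metric.closedBall 0 1)ᶜ = 0 →
      (∀ (x : Plane) (r : ℝ), 0 < r → μ (Metric.closedBall x r) ≤ ENNReal.ofReal (C * r ^ t)) →
      δ = (1 / 2 : ℝ) ^ n →
      (∀ p ∈ dyadicSquaresMeeting δ μ.support,
        𝒯 p ⊆ dyadicTubes δ ∧ (𝒯 p).Nonempty ∧ IsDeltaTubeSet δ s C (𝒯 p) ∧
        ∀ T ∈ 𝒯 p, (T ∩ p).Nonempty) →
      ∃ S S' : Finset (Fin 2 → ℤ), S' ⊆ S ∧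
        (∀ k, k ∈ S ↔ k ∈ tubeCells δ (⋃ p ∈ dyadicSquaresMeeting δ μ.support, 𝒯 p)) ∧
        (∀ k ∈ S, |(k 1 : ℝ) * δ| ≤ 4) ∧
        (∀ (i : ℕ) (y : Fin 2 → ℝ),
          ((S'.filter fun k => ∀ a, |(k a : ℝ) - y a| ≤ 2 ^ i).card : ℝ) ≤
            9 * ((2 : ℝ) ^ i) ^ (σ + 1)) ∧
        c * μ.real Set.univ / C ^ 3 ≤ (S'.card : ℝ) * δ ^ (σ + 1) := by
  -- The given `σ` may be too small for the incidence theorem, so `v` is raised above `2 - t` while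
  -- staying below `s`. This is harmless: spread of dimension `σ + 1` implies spread of dimension `v
  -- + 1`, and `ρ ^ (v + 1) ≤ ρ ^ (σ + 1)` for `ρ ≤ 1`.
  set v := max σ ((2 - t + s) / 2) with hv
  have hvs : v < s := max_lt hσs (by linarith)
  have hv2 : 2 - t < v := lt_of_lt_of_le (by linarith) (le_max_right _ _)
  have hσv : σ ≤ v := le_max_left _ _
  obtain ⟨c, hc, key⟩ := exists_generation_weight_ge ht hv2 hvs hs
  refine ⟨c / 2, by positivity, ?_⟩
  intro C μ n δ 𝒯 hC hμ hball hδ h𝒯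
  have hδ0 : 0 < δ := by rw [hδ]; positivity
  have hδn : (2 : ℝ) ^ n * δ = 1 := by rw [hδ, ← mul_pow]; norm_num
  set D := dyadicSquaresMeeting δ μ.support with hD
  have hmem : ∀ k, k ∈ tubeCells δ (⋃ p ∈ D, 𝒯 p) ↔ ∃ p ∈ D, k ∈ tubeCells δ (𝒯 p) := by
    intro k
    constructor
    · rintro ⟨h1, h2⟩
      rw [Set.mem_iUnion₂] at h2
      obtain ⟨p, hp, hT⟩ := h2
      exact ⟨p, hp, h1, hT⟩
    · rintro ⟨p, hp, h1, h2⟩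
      exact ⟨h1, Set.mem_biUnion hp h2⟩
  have hbounds : ∀ k ∈ tubeCells δ (⋃ p ∈ D, 𝒯 p),
      (0 ≤ k 0 ∧ k 0 < 2 ^ n) ∧ |k 1| ≤ 4 * 2 ^ n := by
    intro k hk
    obtain ⟨p, hp, hk⟩ := (hmem k).1 hk
    have hT := (h𝒯 p hp).2.2.2 _ hk.2
    obtain ⟨⟨q, rfl⟩, x, hx, hxs⟩ := hp
    exact cell_bounds hδ hk.1 hx (support_subset_closedBall hμ hxs) hT
  have hfin : (tubeCells δ (⋃ p ∈ D, 𝒯 p)).Finite := by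
    refine (Set.finite_Icc (fun _ : Fin 2 => -(4 * (2 : ℤ) ^ n))
      fun _ => 4 * (2 : ℤ) ^ n).subset fun k hk => ?_
    obtain ⟨⟨h1, h2⟩, h3⟩ := hbounds k hk
    have h4 := abs_le.1 h3
    have hp : (0 : ℤ) < 2 ^ n := by positivity
    exact Set.mem_Icc.2 ⟨Fin.forall_fin_two.2 ⟨by linarith, h4.1⟩,
      Fin.forall_fin_two.2 ⟨by linarith, h4.2⟩⟩
  obtain ⟨S', hS', hspread, hcov⟩ :=
    exists_maximal_spread_subset hfin.toFinset n (by linarith : 0 ≤ σ + 1)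
  have hS'b : ∀ k ∈ S', (0 ≤ k 0 ∧ k 0 < 2 ^ n) ∧ |k 1| ≤ 4 * 2 ^ n := fun k hk =>
    hbounds k (hfin.mem_toFinset.1 (hS' hk))
  have hbox := card_box_le_of_spread (by linarith) hspread (fun k hk => (hS'b k hk).1)
    fun k hk => (hS'b k hk).2
  refine ⟨hfin.toFinset, S', hS', fun k => hfin.mem_toFinset, fun k hk => ?_, hbox, ?_⟩
  · have h1 : |(k 1 : ℝ)| ≤ 4 * 2 ^ n := by exact_mod_cast (hbounds k (hfin.mem_toFinset.1 hk)).2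
    rw [abs_mul, abs_of_pos hδ0]
    calc |(k 1 : ℝ)| * δ ≤ 4 * 2 ^ n * δ := by gcongr
      _ = 4 := by rw [mul_assoc, hδn, mul_one]
  · obtain ⟨i, hi, hci⟩ := key C μ n δ 𝒯 (saturatedCells S' (σ + 1)) hC hμ hball hδ h𝒯
      (fun p hp k hk => by
        obtain ⟨i, hi, hik⟩ := hcov k (hfin.mem_toFinset.2 ((hmem k).2 ⟨p, hp, hk⟩))
        exact ⟨i, Finset.mem_range.2 (by omega), mem_saturatedCells_of_le hik⟩)
      (fun i _ j y => by
        refine (card_saturatedCells_box_le (by linarith) hbox i j y).trans ?_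
        gcongr
        exact one_le_pow₀ one_le_two)
      (fun i _ l hl => by
        obtain ⟨k, hk, rfl⟩ := (mem_saturatedCells.1 hl).1
        obtain ⟨⟨h1, h2⟩, -⟩ := hS'b k hk
        have h3 : (0 : ℤ) ≤ ancestor i k 0 := Int.ediv_nonneg h1 (by positivity)
        have h4 : (0 : ℝ) ≤ ancestor i k 0 := by exact_mod_cast h3
        have h5 := ancestor_apply_le i k 0
        have h6 : (k 0 : ℝ) ≤ 2 ^ n := by exact_mod_cast h2.le
        refine ⟨by positivity, ?_⟩
        calc (ancestor i k 0 : ℝ) * (2 ^ i * δ) = 2 ^ i * ancestor i k 0 * δ := by ring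
          _ ≤ 2 ^ n * δ := by gcongr; exact h5.trans h6
          _ = 1 := hδn)
    have hin : i ≤ n := by have := Finset.mem_range.1 hi; omega
    have hρ1 : 2 ^ i * δ ≤ 1 := by
      rw [← hδn]
      gcongr
      exact one_le_two
    have h1 : ((2 : ℝ) ^ i * δ) ^ (v + 1) ≤ (2 ^ i * δ) ^ (σ + 1) :=
      Real.rpow_le_rpow_of_exponent_ge (by positivity) hρ1 (by linarith)
    have h2 := card_saturatedCells_mul_le S' (σ + 1) i
    have h3 : c * μ.real Set.univ / C ^ 3 ≤ 2 * ((S'.card : ℝ) * δ ^ (σ + 1)) := by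
      calc _ ≤ _ := hci
        _ ≤ ((saturatedCells S' (σ + 1) i).card : ℝ) * (2 ^ i * δ) ^ (σ + 1) := by gcongr
        _ = ((saturatedCells S' (σ + 1) i).card : ℝ) * ((2 : ℝ) ^ i) ^ (σ + 1) * δ ^ (σ + 1) := by
          rw [Real.mul_rpow (by positivity) hδ0.le, mul_assoc]
        _ ≤ 2 * (S'.card : ℝ) * δ ^ (σ + 1) := by gcongr
        _ = _ := by ring
    calc c / 2 * μ.real Set.univ / C ^ 3 = (c * μ.real Set.univ / C ^ 3) / 2 := by ring
      _ ≤ _ := by linarith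

end Main

end Furstenberg

theorem mainTheorem4 :
    ∃ K : ℝ, 0 < K ∧
    ∀ t s σ : ℝ, 1 < t → t ≤ 2 → 2 - t < s → s ≤ 1 → 0 ≤ σ → σ < s →
    ∃ c : ℝ, 0 < c ∧
    ∀ (C : ℝ) (μ : MeasureTheory.Measure Furstenberg.Plane) (n : ℕ) (δ : ℝ)
      (𝒯 : Set Furstenberg.Plane → Set (Set Furstenberg.Plane)),
      1 ≤ C →
      μ (Metric.closedBall 0 1)ᶜ = 0 →
      (∀ (x : Furstenberg.Plane) (r : ℝ), 0 < r →
        μ (Metric.closedBall x r) ≤ ENNReal.ofReal (C * r ^ t)) →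
      δ = (1 / 2 : ℝ) ^ n →
      (∀ p ∈ Furstenberg.dyadicSquaresMeeting δ μ.support,
        𝒯 p ⊆ Furstenberg.dyadicTubes δ ∧ (𝒯 p).Nonempty ∧
        Furstenberg.IsDeltaTubeSet δ s C (𝒯 p) ∧
        ∀ T ∈ 𝒯 p, (T ∩ p).Nonempty) →
      ENNReal.ofReal c * μ Set.univ / ENNReal.ofReal C ^ 3 ≤
          Furstenberg.tubeContent δ (σ + 1)
            (⋃ p ∈ Furstenberg.dyadicSquaresMeeting δ μ.support, 𝒯 p) ∧
      ∃ 𝒯' ⊆ ⋃ p ∈ Furstenberg.dyadicSquaresMeeting δ μ.support, 𝒯 p,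
        Furstenberg.IsKatzTaoTubeSet δ (σ + 1) K 𝒯' ∧
        ENNReal.ofReal c * μ Set.univ * ENNReal.ofReal (δ ^ (-(σ + 1))) / ENNReal.ofReal C ^ 3 ≤
          (𝒯'.encard : ℝ≥0∞) := by
  refine ⟨10 * 9 * 17424 * 16641, by norm_num, ?_⟩
  intro t s σ _ ht hst hs hσ0 hσs
  obtain ⟨c, hc, key⟩ := Furstenberg.exists_large_spread_cells ht hst hs hσ0 hσs
  -- The loss from cells to tubes, `166410 = 10 * 16641`, also covers the factor `9` in the content
  -- bound.
  refine ⟨c / 166410, by positivity, ?_⟩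
  intro C μ n δ 𝒯 hC hμ hball hδ h𝒯
  obtain ⟨S, S', hS'S, hS, hSb, hbox, hlarge⟩ := key C μ n δ 𝒯 hC hμ hball hδ h𝒯
  have hδ0 : 0 < δ := by rw [hδ]; positivity
  have hδ1 : δ ≤ 1 := by rw [hδ]; exact pow_le_one₀ (by norm_num) (by norm_num)
  have hC0 : 0 < C := by linarith
  have hu : 0 ≤ σ + 1 := by linarith
  have hμtop : μ Set.univ ≠ ⊤ :=
    ((Furstenberg.measure_univ_le hμ hball).trans_lt ENNReal.ofReal_lt_top).ne
  have hμreal : μ Set.univ = ENNReal.ofReal (μ.real Set.univ) := (ENNReal.ofReal_toReal hμtop).symm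
  have hsub : (fun k => Furstenberg.tube (Furstenberg.gridSquare δ k)) '' (S' : Set (Fin 2 → ℤ)) ⊆
      ⋃ p ∈ Furstenberg.dyadicSquaresMeeting δ μ.support, 𝒯 p := by
    rintro _ ⟨k, hk, rfl⟩
    exact ((hS k).1 (hS'S hk)).2
  have hSparam : ∀ k ∈ S, Furstenberg.gridSquare δ k ∈ Furstenberg.paramSquares δ ∧
      |(k 1 : ℝ) * δ| ≤ 4 := fun k hk => ⟨((hS k).1 hk).1, hSb k hk⟩
  have hM : 0 ≤ μ.real Set.univ := MeasureTheory.measureReal_nonneg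
  refine ⟨?_, _, hsub, ?_, ?_⟩
  · refine le_trans ?_ (Furstenberg.le_hausdorffContent hδ0 hu (fun k hk => ?_) hbox)
    · rw [hμreal, ← ENNReal.ofReal_mul (by positivity), ← ENNReal.ofReal_pow hC0.le,
        ← ENNReal.ofReal_div_of_pos (by positivity)]
      refine ENNReal.ofReal_le_ofReal ?_
      have h1 : 0 ≤ c * μ.real Set.univ / C ^ 3 := by positivity
      calc c / 166410 * μ.real Set.univ / C ^ 3 = c * μ.real Set.univ / C ^ 3 / 166410 := by ring
        _ ≤ _ := by linarith
    · rw [Furstenberg.paramUnion_eq]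
      exact Set.mem_biUnion ((hS k).1 (hS'S hk)) (Furstenberg.corner_mem_gridSquare hδ0 k)
  · exact Furstenberg.isKatzTaoTubeSet_image hδ0 hδ1 hu (by linarith) hS'S hSparam
      (fun k hk => (hS k).2 ⟨hk.1, hsub hk.2⟩) hbox
  · have h1 := Furstenberg.card_le_mul_encard_image hδ0 hδ1 fun k hk => hSparam k (hS'S hk)
    have h2 : c / 166410 * μ.real Set.univ * δ ^ (-(σ + 1)) / C ^ 3 ≤ (S'.card : ℝ) / 166410 := by
      have h3 : (0 : ℝ) < δ ^ (σ + 1) := by positivity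
      rw [Real.rpow_neg hδ0.le]
      calc c / 166410 * μ.real Set.univ * (δ ^ (σ + 1))⁻¹ / C ^ 3 =
            c * μ.real Set.univ / C ^ 3 * ((δ ^ (σ + 1))⁻¹ / 166410) := by ring
        _ ≤ (S'.card : ℝ) * δ ^ (σ + 1) * ((δ ^ (σ + 1))⁻¹ / 166410) := by gcongr
        _ = (S'.card : ℝ) / 166410 := by field_simp
    rw [hμreal, ← ENNReal.ofReal_mul (by positivity), ← ENNReal.ofReal_mul (by positivity),
      ← ENNReal.ofReal_pow hC0.le, ← ENNReal.ofReal_div_of_pos (by positivity)]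
    refine (ENNReal.ofReal_le_ofReal h2).trans ?_
    rw [ENNReal.ofReal_div_of_pos (by norm_num), ENNReal.ofReal_natCast, ENNReal.ofReal_ofNat]
    exact ENNReal.div_le_of_le_mul' h1
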